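/- Let $H$ be a complex Hilbert space and let $M_0,M_1\in L(H)$ be bounded linear operators such that the range $R(M_0)$ is closed. Let $\mathcal M(z)=zM_0+M_1$ ($z\in\mathbb C$) be the linear operator pencil associated with $(M_0,M_1)$, and let $\sigma(\mathcal M)=\{z\in\mathbb C : 0\in\sigma(zM_0+M_1)\}$ be its spectrum. Assume that $\mathcal M$ is regular (of index $0$): there is $\nu\in\mathbb R$ such that every $z$ with $\operatorname{Re} z>\nu$ lies outside $\sigma(\mathcal M)$ and $z\mapsto \mathcal M(z)^{-1}\in L(H)$ is bounded on $\{\operatorname{Re} z>\nu\}$. Let $\mathcal N(z)=zM_0-M_1$ be the pencil associated with $(M_0,-M_1)$. For $\rho\in\mathbb R$ and a Hilbert space $E$, let $L_{2,\rho}(\mathbb R;E)$ be the space of (classes of) measurable $f:\mathbb R\to E$ with $\int_{\mathbb R}\|f(t)\|^2e^{-2\rho t}\,dt<\infty$, and let $\mathcal L_\rho:L_{2,\rho}(\mathbb R;H)\to L_2(\mathbb R;H)$ be the Fourier–Laplace transform, i.e. the unitary extension of $\varphi\mapsto\bigl(t\mapsto\frac1{\sqrt{2\pi}}\int_{\mathbb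 R}e^{-(it+\rho)s}\varphi(s)\,ds\bigr)$, $\varphi\in C_c^\infty(\mathbb R;H)$. Call $\mu>0$ admissible if $\sigma(\mathcal M)\subseteq B(0,\mu)$ and $\sup_{z\in\mathbb C\setminus B(0,\mu)}\|\mathcal M(z)^{-1}\|<\infty$, where $B(0,\mu)$ is the open disc of radius $\mu$ about $0$; then $\mu$ is admissible for $\mathcal N$ as well. For an admissible $\mu$ the mild solution with initial value $u_0\in H$ is $$S(\mathcal M)u_0=\mathcal L_\mu^{*}\Bigl(t\mapsto\tfrac1{\sqrt{2\pi}}\,\mathcal M(it+\mu)^{-1}M_0u_0\Bigr)\in L_{2,\mu}(\mathbb R;H),$$ and $S(\mathcal N)u_0$ is defined in the same way with $\mathcal N$ in place of $\mathcal M$. Let $P:H\to N(M_0)^\perp$ be the orthogonal projection onto the orthogonal complement of the kernel of $M_0$. The pencil $\mathcal M$ admits a mild exponential dichotomy with respect to closed subspaces $S,T\subseteq N(M_0)^\perp$ if $S\dotplus T=N(M_0)^\perp$ (direct, not necessarily orthogonal, sum) and there is $\rho>0$ such that $$P\,S(\mathcal M)u_0\in L_{2,-\rho}(\mathbb R;S)\quad(u_0\in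 S),\qquad P\,S(\mathcal N)u_0\in L_{2,-\rho}(\mathbb R;T)\quad(u_0\in T).$$ It admits a mild exponential dichotomy if this holds for some such $S,T$, and it is mildly exponentially stable if this holds for $S=N(M_0)^\perp$ and $T=\{0\}$. Theorem. Admissible $\mu$ exist, and for every admissible $\mu$ the following holds: 1. $\mathcal M$ admits a mild exponential dichotomy if and only if $\sigma(\mathcal M)\cap i\mathbb R=\emptyset$. 2. $\mathcal M$ is mildly exponentially stable if and only if $\sigma(\mathcal M)\subseteq\{z\in\mathbb C:\operatorname{Re} z<0\}$. -/

import Mathlib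

open MeasureTheory

/-! ### Linear operator pencils -/

section Pencil

variable {H : Type*} [NormedAddCommGroup H] [InnerProductSpace ℂ H]

/-- The linear operator pencil `z ↦ z M₀ + M₁` associated with `(M₀, M₁)`. -/
def pencil (M₀ M₁ : H →L[ℂ] H) (z : ℂ) : H →L[ℂ] H := z • M₀ + M₁

/-- The spectrum of the pencil: all `z` with `0 ∈ σ(z M₀ + M₁)`. -/
def pencilSpectrum (M₀ M₁ : H →L[ℂ] H) : Set ℂ :=
  {z : ℂ | (0 : ℂ) ∈ spectrum ℂ (pencil M₀ M₁ z)}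

/-- The inverse `(z M₀ + M₁)⁻¹` in `L(H)` (only used for `z` outside the spectrum). -/
noncomputable def pencilInv (M₀ M₁ : H →L[ℂ] H) (z : ℂ) : H →L[ℂ] H :=
  Ring.inverse (pencil M₀ M₁ z)

/-- Regularity (of index `0`): some open right half plane lies in the resolvent set of the
pencil, and the inverse is bounded there. -/
def IsRegularPencil (M₀ M₁ : H →L[ℂ] H) : Prop :=
  ∃ ν : ℝ, (∀ z : ℂ, ν < z.re → z ∉ pencilSpectrum M₀ M₁) ∧
    ∃ C : ℝ, ∀ z : ℂ, ν < z.re → ‖pencilInv M₀ M₁ z‖ ≤ C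

/-- `μ > 0` is such that the inverse of the pencil exists and is uniformly bounded on the
complement of the open ball of radius `μ` about the origin. -/
structure IsAdmissibleRadius (M₀ M₁ : H →L[ℂ] H) (μ : ℝ) : Prop where
  pos : 0 < μ
  notMem_spectrum : ∀ z : ℂ, z ∉ Metric.ball (0 : ℂ) μ → z ∉ pencilSpectrum M₀ M₁
  bounded : ∃ C : ℝ, ∀ z : ℂ, z ∉ Metric.ball (0 : ℂ) μ → ‖pencilInv M₀ M₁ z‖ ≤ C

theorem isUnit_pencil {M₀ M₁ : H →L[ℂ] H} {z : ℂ} (hz : z ∉ pencilSpectrum M₀ M₁) :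
    IsUnit (pencil M₀ M₁ z) := by
  have h := spectrum.zero_notMem_iff (R := ℂ) (a := pencil M₀ M₁ z)
  exact h.mp hz

theorem pencil_neg (M₀ M₁ : H →L[ℂ] H) (z : ℂ) :
    pencil M₀ (-M₁) z = -pencil M₀ M₁ (-z) := by
  simp [pencil, add_comm]

/-- The reversed pencil `(M₀, -M₁)` has the same admissible radii. -/
theorem IsAdmissibleRadius.reverse {M₀ M₁ : H →L[ℂ] H} {μ : ℝ}
    (h : IsAdmissibleRadius M₀ M₁ μ) : IsAdmissibleRadius M₀ (-M₁) μ := by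
  have hb : ∀ z : ℂ, z ∉ Metric.ball (0 : ℂ) μ → -z ∉ Metric.ball (0 : ℂ) μ := by
    intro z hz
    simpa using hz
  refine ⟨h.pos, ?_, ?_⟩
  · intro z hz
    have hu : IsUnit (pencil M₀ M₁ (-z)) := isUnit_pencil (h.notMem_spectrum _ (hb z hz))
    have hu' : IsUnit (pencil M₀ (-M₁) z) := by
      rw [pencil_neg]; exact hu.neg
    exact spectrum.zero_notMem_iff (R := ℂ) |>.mpr hu'
  · obtain ⟨C, hC⟩ := h.bounded
    refine ⟨C, fun z hz => ?_⟩
    have : pencilInv M₀ (-M₁) z = -pencilInv M₀ M₁ (-z) := by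
      obtain ⟨x, hx⟩ := isUnit_pencil (h.notMem_spectrum _ (hb z hz))
      rw [pencilInv, pencilInv, pencil_neg, ← hx, ← Units.val_neg, Ring.inverse_unit,
        Ring.inverse_unit, inv_neg, Units.val_neg]
    rw [this, norm_neg]
    exact hC _ (hb z hz)

end Pencil

/-! ### Exponentially weighted `L₂`-spaces and the Fourier–Laplace transform -/

section Weighted

variable (H : Type*) [NormedAddCommGroup H] [InnerProductSpace ℂ H]

/-- The measure `exp (-2 ρ t) dt` on `ℝ`; the space `L_{2,ρ}(ℝ; H)` is
`Lp H 2 (weightedMeasure ρ)`. -/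
noncomputable def weightedMeasure (ρ : ℝ) : Measure ℝ :=
  volume.withDensity fun t => ENNReal.ofReal (Real.exp (-2 * ρ * t))

variable {H}

section Weight

variable {w : ℝ → ℝ} {d : ℝ → ENNReal}

theorem ae_weight (hw : Measurable w) (hpos : ∀ t, 0 < w t)
    (hd : ∀ t, d t = ENNReal.ofReal (w t) ^ 2) :
    ae (volume.withDensity d) = ae (volume : Measure ℝ) := by
  have hdm : Measurable d := by
    rw [funext hd]; fun_prop
  ext s
  have := ae_withDensity_iff (μ := (volume : Measure ℝ)) (p := fun x => x ∈ s) hdm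
  change (∀ᵐ x ∂(volume.withDensity d), x ∈ s) ↔ ∀ᵐ x ∂(volume : Measure ℝ), x ∈ s
  rw [this]
  refine Filter.eventually_congr (Filter.Eventually.of_forall fun t => ?_)
  have h0 : d t ≠ 0 := by
    rw [hd]
    exact pow_ne_zero _ (by simpa using hpos t)
  simp [h0]

theorem eLpNorm_weight (hw : Measurable w) (hpos : ∀ t, 0 < w t)
    (hd : ∀ t, d t = ENNReal.ofReal (w t) ^ 2) (f : ℝ → H) :
    eLpNorm f 2 (volume.withDensity d) = eLpNorm (fun t => w t • f t) 2 volume := by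
  have hdm : Measurable d := by
    rw [funext hd]; fun_prop
  rw [eLpNorm_eq_lintegral_rpow_enorm_toReal (by norm_num) (by norm_num),
    eLpNorm_eq_lintegral_rpow_enorm_toReal (by norm_num) (by norm_num),
    lintegral_withDensity_eq_lintegral_mul_non_measurable _ hdm
      (Filter.Eventually.of_forall fun t => by rw [hd]; simp)]
  congr 1
  refine lintegral_congr fun t => ?_
  have h1 : ‖w t‖ₑ = ENNReal.ofReal (w t) := Real.enorm_of_nonneg (hpos t).le
  simp only [Pi.mul_apply, enorm_smul, hd, h1, ENNReal.toReal_ofNat, ENNReal.rpow_ofNat, mul_pow]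

theorem memLp_weight_iff (hw : Measurable w) (hpos : ∀ t, 0 < w t)
    (hd : ∀ t, d t = ENNReal.ofReal (w t) ^ 2) {f : ℝ → H} :
    MemLp f 2 (volume.withDensity d) ↔ MemLp (fun t => w t • f t) 2 volume := by
  have hae := ae_weight hw hpos hd
  have hm : AEStronglyMeasurable f (volume.withDensity d) ↔
      AEStronglyMeasurable (fun t => w t • f t) volume := by
    constructor
    · rintro ⟨g, hg, hfg⟩
      rw [Filter.EventuallyEq, hae] at hfg
      refine ⟨fun t => w t • g t, hw.stronglyMeasurable.smul hg, ?_⟩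
      filter_upwards [hfg] with t ht
      rw [ht]
    · rintro ⟨g, hg, hfg⟩
      refine ⟨fun t => (w t)⁻¹ • g t, hw.inv.stronglyMeasurable.smul hg, ?_⟩
      rw [Filter.EventuallyEq, hae]
      filter_upwards [hfg] with t ht
      rw [← ht, smul_smul, inv_mul_cancel₀ (hpos t).ne', one_smul]
  rw [MemLp, MemLp, hm, eLpNorm_weight hw hpos hd]

theorem memLp_weight_inv (hw : Measurable w) (hpos : ∀ t, 0 < w t)
    (hd : ∀ t, d t = ENNReal.ofReal (w t) ^ 2) (g : Lp H 2 (volume : Measure ℝ)) :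
    MemLp (fun t => (w t)⁻¹ • g t) 2 (volume.withDensity d) :=
  (memLp_weight_iff hw hpos hd).mpr (by
    have : (fun t => w t • (w t)⁻¹ • g t) = g := by
      funext t
      rw [smul_smul, mul_inv_cancel₀ (hpos t).ne', one_smul]
    rw [this]
    exact Lp.memLp g)

/-- Multiplication by the positive weight `w` as a unitary operator from `L₂(w² dt)` onto
`L₂(dt)`. -/
noncomputable def weightIso (hw : Measurable w) (hpos : ∀ t, 0 < w t)
    (hd : ∀ t, d t = ENNReal.ofReal (w t) ^ 2) :
    Lp H 2 (volume.withDensity d) ≃ₗᵢ[ℂ] Lp H 2 (volume : Measure ℝ) :=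
  LinearIsometryEquiv.mk
    { toFun := fun f => ((memLp_weight_iff hw hpos hd).mp (Lp.memLp f)).toLp _
      map_add' := by
        intro f g
        rw [← MemLp.toLp_add, MemLp.toLp_eq_toLp_iff]
        have h := Lp.coeFn_add f g
        rw [Filter.EventuallyEq, ae_weight hw hpos hd] at h
        filter_upwards [h] with t ht
        change w t • (f + g : Lp H 2 (volume.withDensity d)) t = w t • f t + w t • g t
        rw [ht, Pi.add_apply, smul_add]
      map_smul' := by
        intro c f
        rw [RingHom.id_apply, ← MemLp.toLp_const_smul, MemLp.toLp_eq_toLp_iff]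
        have h := Lp.coeFn_smul c f
        rw [Filter.EventuallyEq, ae_weight hw hpos hd] at h
        filter_upwards [h] with t ht
        change w t • (c • f : Lp H 2 (volume.withDensity d)) t = c • w t • f t
        rw [ht, Pi.smul_apply, smul_comm]
      invFun := fun g => MemLp.toLp (fun t => (w t)⁻¹ • g t)
        (memLp_weight_inv hw hpos hd g)
      left_inv := by
        intro f
        apply Lp.ext
        refine (MemLp.coeFn_toLp _).trans ?_
        rw [Filter.EventuallyEq, ae_weight hw hpos hd]
        filter_upwards [MemLp.coeFn_toLp ((memLp_weight_iff hw hpos hd).mp (Lp.memLp f))] with t ht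
        rw [ht, smul_smul, inv_mul_cancel₀ (hpos t).ne', one_smul]
      right_inv := by
        intro g
        apply Lp.ext
        refine (MemLp.coeFn_toLp _).trans ?_
        have h := (memLp_weight_inv hw hpos hd g).coeFn_toLp
        rw [Filter.EventuallyEq, ae_weight hw hpos hd] at h
        refine h.mono fun t ht => ?_
        change w t • (memLp_weight_inv hw hpos hd g).toLp _ t = g t
        rw [ht, smul_smul, mul_inv_cancel₀ (hpos t).ne', one_smul] }
    (by
      intro f
      change ‖((memLp_weight_iff hw hpos hd).mp (Lp.memLp f)).toLp _‖ = ‖f‖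
      rw [Lp.norm_toLp, Lp.norm_def, eLpNorm_weight hw hpos hd])

theorem weightIso_toLp (hw : Measurable w) (hpos : ∀ t, 0 < w t)
    (hd : ∀ t, d t = ENNReal.ofReal (w t) ^ 2) {f : ℝ → H}
    (hf : MemLp f 2 (volume.withDensity d)) :
    weightIso hw hpos hd (hf.toLp f) = ((memLp_weight_iff hw hpos hd).mp hf).toLp _ := by
  change ((memLp_weight_iff hw hpos hd).mp (Lp.memLp (hf.toLp f))).toLp _ = _
  rw [MemLp.toLp_eq_toLp_iff]
  have h := hf.coeFn_toLp
  rw [Filter.EventuallyEq, ae_weight hw hpos hd] at h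
  filter_upwards [h] with t ht
  rw [ht]

end Weight

theorem weight_exp (ρ t : ℝ) :
    ENNReal.ofReal (Real.exp (-2 * ρ * t)) = ENNReal.ofReal (Real.exp (-ρ * t)) ^ 2 := by
  rw [← ENNReal.ofReal_pow (Real.exp_pos _).le, ← Real.exp_nat_mul]
  congr 2
  push_cast
  ring

/-- The unitary operator `f ↦ exp (-ρ ·) f` from `L_{2,ρ}(ℝ; H)` onto `L₂(ℝ; H)`. -/
noncomputable def expIso (ρ : ℝ) :
    Lp H 2 (weightedMeasure ρ) ≃ₗᵢ[ℂ] Lp H 2 (volume : Measure ℝ) :=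
  weightIso (w := fun t => Real.exp (-ρ * t)) (by fun_prop) (fun _ => Real.exp_pos _)
    (weight_exp ρ)

theorem measurePreserving_div_two_pi :
    MeasurePreserving (fun t : ℝ => t / (2 * Real.pi)) volume
      (volume.withDensity fun _ => ENNReal.ofReal (√(2 * Real.pi)) ^ 2) := by
  refine ⟨by fun_prop, ?_⟩
  have hpos : (0 : ℝ) < 2 * Real.pi := by positivity
  rw [withDensity_const, ← ENNReal.ofReal_pow (Real.sqrt_nonneg _), Real.sq_sqrt hpos.le]
  have h := Real.map_volume_mul_right (a := (2 * Real.pi)⁻¹) (inv_ne_zero hpos.ne')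
  simp only [inv_inv, abs_of_pos hpos] at h
  simpa only [div_eq_mul_inv] using h

theorem measurePreserving_mul_two_pi :
    MeasurePreserving (fun t : ℝ => t * (2 * Real.pi))
      (volume.withDensity fun _ => ENNReal.ofReal (√(2 * Real.pi)) ^ 2) volume := by
  have hpos : (0 : ℝ) < 2 * Real.pi := by positivity
  refine ⟨by fun_prop, ?_⟩
  rw [← measurePreserving_div_two_pi.map_eq, Measure.map_map (by fun_prop) (by fun_prop)]
  have : (fun t : ℝ => t * (2 * Real.pi)) ∘ (fun t : ℝ => t / (2 * Real.pi)) = id := by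
    funext t
    simp [div_mul_cancel₀ _ hpos.ne']
  rw [this, Measure.map_id]

/-- The unitary dilation `g ↦ (t ↦ (2π)^{-1/2} g (t / 2π))` of `L₂(ℝ; H)`. -/
noncomputable def dilationIso :
    Lp H 2 (volume : Measure ℝ) ≃ₗᵢ[ℂ] Lp H 2 (volume : Measure ℝ) :=
  (weightIso (H := H) (w := fun _ => √(2 * Real.pi))
    (d := fun _ => ENNReal.ofReal (√(2 * Real.pi)) ^ 2) (by fun_prop)
    (fun _ => Real.sqrt_pos.mpr (by positivity)) (fun _ => rfl)).symm.trans
  (LinearIsometryEquiv.mk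
    (LinearEquiv.ofLinearMap
      (Lp.compMeasurePreservingₗ ℂ (fun t : ℝ => t / (2 * Real.pi)) measurePreserving_div_two_pi)
      (Lp.compMeasurePreservingₗ ℂ (fun t : ℝ => t * (2 * Real.pi)) measurePreserving_mul_two_pi)
      (by
        have hpos : (2 * Real.pi : ℝ) ≠ 0 := by positivity
        ext1 f
        apply Lp.ext
        refine (Lp.coeFn_compMeasurePreserving _ measurePreserving_div_two_pi).trans ?_
        refine (measurePreserving_div_two_pi.quasiMeasurePreserving.ae_eq_comp
          (Lp.coeFn_compMeasurePreserving f measurePreserving_mul_two_pi)).trans ?_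
        refine Filter.Eventually.of_forall fun t => ?_
        simp [div_mul_cancel₀ _ hpos])
      (by
        have hpos : (2 * Real.pi : ℝ) ≠ 0 := by positivity
        ext1 f
        apply Lp.ext
        refine (Lp.coeFn_compMeasurePreserving _ measurePreserving_mul_two_pi).trans ?_
        refine (measurePreserving_mul_two_pi.quasiMeasurePreserving.ae_eq_comp
          (Lp.coeFn_compMeasurePreserving f measurePreserving_div_two_pi)).trans ?_
        refine Filter.Eventually.of_forall fun t => ?_
        simp [mul_div_cancel_right₀ _ hpos]))
    (fun f => Lp.norm_compMeasurePreserving f measurePreserving_div_two_pi))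

theorem dilationIso_apply (g : Lp H 2 (volume : Measure ℝ)) :
    (dilationIso g : ℝ → H) =ᵐ[volume]
      fun t => (√(2 * Real.pi))⁻¹ • g (t / (2 * Real.pi)) := by
  refine (Lp.coeFn_compMeasurePreserving _ measurePreserving_div_two_pi).trans ?_
  exact measurePreserving_div_two_pi.quasiMeasurePreserving.ae_eq_comp
    (memLp_weight_inv (w := fun _ => √(2 * Real.pi)) (by fun_prop)
      (fun _ => Real.sqrt_pos.mpr (by positivity)) (fun _ => rfl) g).coeFn_toLp

/-- The Fourier–Laplace transform, the unitary operator from `L_{2,ρ}(ℝ; H)` onto `L₂(ℝ; H)`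
that is given on test functions by
`φ ↦ (t ↦ (2π)^{-1/2} ∫ exp (-(i t + ρ) s) φ(s) ds)`; see `fourierLaplace_toLp`. It is
composed of multiplication by `exp (-ρ ·)`, the Fourier transform on `L₂(ℝ; H)`
(with kernel `exp (-2π i s t)`), and the dilation that passes to the kernel `exp (-i s t)`. -/
noncomputable def fourierLaplace [CompleteSpace H] (ρ : ℝ) :
    Lp H 2 (weightedMeasure ρ) ≃ₗᵢ[ℂ] Lp H 2 (volume : Measure ℝ) :=
  ((expIso ρ).trans (Lp.fourierTransformₗᵢ ℝ H)).trans dilationIso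

theorem memLp_weightedMeasure_of_hasCompactSupport (ρ : ℝ) {φ : ℝ → H}
    (hφ : Continuous φ) (hc : HasCompactSupport φ) : MemLp φ 2 (weightedMeasure ρ) :=
  (memLp_weight_iff (w := fun t => Real.exp (-ρ * t)) (by fun_prop) (fun _ => Real.exp_pos _)
    (weight_exp ρ)).mpr
      ((by fun_prop : Continuous fun t => Real.exp (-ρ * t) • φ t).memLp_of_hasCompactSupport
        hc.smul_left)

theorem fourierLaplace_apply [CompleteSpace H] (ρ : ℝ) (f : Lp H 2 (weightedMeasure ρ)) :
    fourierLaplace ρ f = dilationIso (Lp.fourierTransformₗᵢ ℝ H (expIso ρ f)) := rfl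

theorem fourierTransform_toLp [CompleteSpace H] (ψ : SchwartzMap ℝ H) :
    Lp.fourierTransformₗᵢ ℝ H (ψ.toLp 2 (volume : Measure ℝ)) =
      (FourierTransform.fourier ψ).toLp 2 (volume : Measure ℝ) :=
  SchwartzMap.toLp_fourier_eq ψ

theorem dilationIso_toLp (ψ : SchwartzMap ℝ H) :
    (dilationIso (ψ.toLp 2 (volume : Measure ℝ)) : ℝ → H) =ᵐ[volume]
      fun t => (√(2 * Real.pi))⁻¹ • ψ (t / (2 * Real.pi)) := by
  refine (dilationIso_apply _).trans ?_
  have h1 : (ψ.toLp 2 (volume : Measure ℝ) : ℝ → H)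
      =ᵐ[volume.withDensity fun _ => ENNReal.ofReal (√(2 * Real.pi)) ^ 2] ψ :=
    (withDensity_absolutelyContinuous _ _).ae_eq (ψ.coeFn_toLp 2 volume)
  have h2 := measurePreserving_div_two_pi.quasiMeasurePreserving.ae_eq_comp h1
  refine h2.mono fun t ht => ?_
  simp only [Function.comp_apply] at ht
  simp only [ht]

theorem expIso_toLp (ρ : ℝ) {φ : ℝ → H} (hφ : MemLp φ 2 (weightedMeasure ρ))
    {ψ : SchwartzMap ℝ H} (hψ : ∀ t, ψ t = Real.exp (-ρ * t) • φ t) :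
    expIso ρ (hφ.toLp φ) = ψ.toLp 2 (volume : Measure ℝ) := by
  refine (weightIso_toLp _ _ _ hφ).trans ?_
  apply Lp.ext
  refine (MemLp.coeFn_toLp _).trans ?_
  refine Filter.EventuallyEq.trans ?_ (ψ.coeFn_toLp 2 volume).symm
  exact Filter.Eventually.of_forall fun t => (hψ t).symm

theorem fourier_exp_mul (ρ : ℝ) {φ : ℝ → H} {ψ : ℝ → H}
    (hψ : ∀ t, ψ t = Real.exp (-ρ * t) • φ t) (t : ℝ) :
    FourierTransform.fourier ψ (t / (2 * Real.pi)) =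
      ∫ s : ℝ, Complex.exp (-(Complex.I * (t : ℂ) + (ρ : ℂ)) * (s : ℂ)) • φ s := by
  rw [Real.fourier_eq']
  refine integral_congr_ae (Filter.Eventually.of_forall fun s => ?_)
  have hpi : (Real.pi : ℂ) ≠ 0 := by exact_mod_cast Real.pi_ne_zero
  simp only [hψ]
  rw [← Complex.coe_smul, smul_smul, Complex.ofReal_exp, ← Complex.exp_add]
  congr 2
  simp only [RCLike.inner_apply, conj_trivial]
  push_cast
  field_simp
  ring

/-- The defining formula of the Fourier–Laplace transform on test functions. -/
theorem fourierLaplace_toLp [CompleteSpace H] (ρ : ℝ) {φ : ℝ → H}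
    (hφ : ContDiff ℝ (⊤ : ℕ∞) φ) (hc : HasCompactSupport φ) :
    (fourierLaplace ρ
        ((memLp_weightedMeasure_of_hasCompactSupport ρ hφ.continuous hc).toLp φ) : ℝ → H)
      =ᵐ[volume] fun t => (√(2 * Real.pi))⁻¹ •
        ∫ s : ℝ, Complex.exp (-(Complex.I * (t : ℂ) + (ρ : ℂ)) * (s : ℂ)) • φ s := by
  have hs : ContDiff ℝ (⊤ : ℕ∞) (fun t => Real.exp (-ρ * t) • φ t) :=
    (by fun_prop : ContDiff ℝ (⊤ : ℕ∞) fun t : ℝ => Real.exp (-ρ * t)).smul hφ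
  have hsc : HasCompactSupport (fun t => Real.exp (-ρ * t) • φ t) := hc.smul_left
  have hψ : ∀ t, hsc.toSchwartzMap hs t = Real.exp (-ρ * t) • φ t := fun _ => rfl
  rw [fourierLaplace_apply, expIso_toLp ρ _ hψ, fourierTransform_toLp]
  refine (dilationIso_toLp _).trans (Filter.Eventually.of_forall fun t => ?_)
  simp only [SchwartzMap.fourier_coe, fourier_exp_mul ρ hψ t]

end Weighted

/-! ### Mild solutions and mild exponential dichotomies -/

section Dichotomy

variable {H : Type*} [NormedAddCommGroup H] [InnerProductSpace ℂ H] [CompleteSpace H]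

/-- The function `t ↦ (2π)^{-1/2} ((i t + μ) M₀ + M₁)⁻¹ M₀ u₀`. -/
noncomputable def solutionSymbol (M₀ M₁ : H →L[ℂ] H) (μ : ℝ) (u₀ : H) (t : ℝ) : H :=
  (√(2 * Real.pi))⁻¹ • pencilInv M₀ M₁ (Complex.I * (t : ℂ) + (μ : ℂ)) (M₀ u₀)

theorem memLp_solutionSymbol {M₀ M₁ : H →L[ℂ] H} {μ : ℝ} (h : IsAdmissibleRadius M₀ M₁ μ)
    (u₀ : H) : MemLp (solutionSymbol M₀ M₁ μ u₀) 2 (volume : Measure ℝ) := by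
  have hμ := h.pos
  obtain ⟨C, hC⟩ := h.bounded
  have hnorm : ∀ t : ℝ, ‖Complex.I * (t : ℂ) + (μ : ℂ)‖ ^ 2 = μ ^ 2 + t ^ 2 := by
    intro t
    rw [← Complex.normSq_eq_norm_sq, Complex.normSq_apply]
    simp
    ring
  have hball : ∀ t : ℝ, Complex.I * (t : ℂ) + (μ : ℂ) ∉ Metric.ball (0 : ℂ) μ := by
    intro t ht
    rw [mem_ball_zero_iff] at ht
    have h1 := hnorm t
    have h2 := norm_nonneg (Complex.I * (t : ℂ) + (μ : ℂ))
    nlinarith [sq_nonneg t]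
  have hunit : ∀ t : ℝ, IsUnit (pencil M₀ M₁ (Complex.I * (t : ℂ) + (μ : ℂ))) :=
    fun t => isUnit_pencil (h.notMem_spectrum _ (hball t))
  have hcont : Continuous (solutionSymbol M₀ M₁ μ u₀) := by
    have hp : Continuous fun t : ℝ => pencil M₀ M₁ (Complex.I * (t : ℂ) + (μ : ℂ)) := by
      unfold pencil
      fun_prop
    have hi : Continuous fun t : ℝ => pencilInv M₀ M₁ (Complex.I * (t : ℂ) + (μ : ℂ)) := by
      rw [continuous_iff_continuousAt]
      intro t
      obtain ⟨x, hx⟩ := hunit t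
      have := NormedRing.inverse_continuousAt x
      rw [hx] at this
      exact ContinuousAt.comp (f := fun t : ℝ => pencil M₀ M₁ (Complex.I * (t : ℂ) + (μ : ℂ)))
        this hp.continuousAt
    unfold solutionSymbol
    exact (hi.clm_apply continuous_const).const_smul _
  rw [memLp_two_iff_integrable_sq_norm hcont.aestronglyMeasurable]
  set K : ℝ := ‖u₀‖ + C * ‖M₁ u₀‖ with hK
  have hbound : ∀ t : ℝ, ‖solutionSymbol M₀ M₁ μ u₀ t‖ ^ 2
      ≤ ((√(2 * Real.pi))⁻¹ * K) ^ 2 * (μ ^ 2 + t ^ 2)⁻¹ := by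
    intro t
    set z : ℂ := Complex.I * (t : ℂ) + (μ : ℂ) with hz
    have hzpos : 0 < ‖z‖ := by
      have := hball t
      rw [mem_ball_zero_iff, not_lt] at this
      exact hμ.trans_le this
    have hid : z • pencilInv M₀ M₁ z (M₀ u₀) = u₀ - pencilInv M₀ M₁ z (M₁ u₀) := by
      have hinv : pencilInv M₀ M₁ z * pencil M₀ M₁ z = 1 :=
        Ring.inverse_mul_cancel _ (hunit t)
      have h1 := DFunLike.congr_fun hinv u₀
      have h2 : pencil M₀ M₁ z u₀ = z • M₀ u₀ + M₁ u₀ := rfl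
      rw [mul_apply_eq_comp, h2, map_add, map_smul, one_apply_eq_self] at h1
      exact eq_sub_of_add_eq h1
    have h3 : ‖z‖ * ‖pencilInv M₀ M₁ z (M₀ u₀)‖ ≤ K := by
      rw [← norm_smul, hid]
      refine (norm_sub_le _ _).trans ?_
      have := (pencilInv M₀ M₁ z).le_of_opNorm_le (hC z (hball t)) (M₁ u₀)
      rw [hK]
      linarith
    have h4 : ‖pencilInv M₀ M₁ z (M₀ u₀)‖ ≤ K * ‖z‖⁻¹ := by
      rw [← div_eq_mul_inv, le_div_iff₀ hzpos, mul_comm]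
      exact h3
    have h5 : ‖solutionSymbol M₀ M₁ μ u₀ t‖ ≤ (√(2 * Real.pi))⁻¹ * K * ‖z‖⁻¹ := by
      rw [solutionSymbol, norm_smul, Real.norm_of_nonneg (by positivity), mul_assoc]
      gcongr
    calc ‖solutionSymbol M₀ M₁ μ u₀ t‖ ^ 2
        ≤ ((√(2 * Real.pi))⁻¹ * K * ‖z‖⁻¹) ^ 2 := by gcongr
      _ = ((√(2 * Real.pi))⁻¹ * K) ^ 2 * (μ ^ 2 + t ^ 2)⁻¹ := by
        rw [mul_pow _ (‖z‖⁻¹), inv_pow, hnorm t]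
  have hint : Integrable fun t : ℝ => (μ ^ 2 + t ^ 2)⁻¹ := by
    have h6 := (integrable_inv_one_add_sq.comp_div hμ.ne').const_mul (μ ^ 2)⁻¹
    refine h6.congr (Filter.Eventually.of_forall fun t => ?_)
    have : μ ^ 2 + t ^ 2 ≠ 0 := by positivity
    have : 1 + (t / μ) ^ 2 ≠ 0 := by positivity
    field_simp
  refine (hint.const_mul (((√(2 * Real.pi))⁻¹ * K) ^ 2)).mono'
    (hcont.norm.pow 2).aestronglyMeasurable (Filter.Eventually.of_forall fun t => ?_)
  rw [Real.norm_of_nonneg (by positivity)]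
  exact hbound t

/-- The solution operator of the pencil `(M₀, M₁)`: it maps an initial value `u₀ ∈ H` to the mild
solution in `L_{2,μ}(ℝ; H)`, the function whose Fourier–Laplace transform is
`t ↦ (2π)^{-1/2} ((i t + μ) M₀ + M₁)⁻¹ M₀ u₀`. -/
noncomputable def solutionOperator {M₀ M₁ : H →L[ℂ] H} {μ : ℝ}
    (h : IsAdmissibleRadius M₀ M₁ μ) (u₀ : H) : Lp H 2 (weightedMeasure μ) :=
  (fourierLaplace μ).symm ((memLp_solutionSymbol h u₀).toLp _)

/-- The mild solution with initial value `u₀`, followed by the orthogonal projection of `H`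
onto `N(M₀)ᗮ`, as a function with values in `N(M₀)ᗮ`. -/
noncomputable def projectedSolution {M₀ M₁ : H →L[ℂ] H} {μ : ℝ}
    (h : IsAdmissibleRadius M₀ M₁ μ) (u₀ : H) (t : ℝ) : (M₀.ker)ᗮ :=
  (M₀.ker)ᗮ.orthogonalProjectionOnto (solutionOperator h u₀ t)

/-- `f ∈ L_{2,ρ}(ℝ; S)` for a closed subspace `S` of `E`. -/
def MemWeightedL2 {E : Type*} [NormedAddCommGroup E] [InnerProductSpace ℂ E]
    (ρ : ℝ) (S : Submodule ℂ E) (f : ℝ → E) : Prop :=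
  MemLp f 2 (weightedMeasure ρ) ∧ ∀ᵐ t : ℝ, f t ∈ S

/-- The pencil `(M₀, M₁)` admits a mild exponential dichotomy with respect to the closed
subspaces `S` and `T` of `N(M₀)ᗮ`. -/
def IsMildExpDichotomy {M₀ M₁ : H →L[ℂ] H} {μ : ℝ} (h : IsAdmissibleRadius M₀ M₁ μ)
    (S T : Submodule ℂ (M₀.ker)ᗮ) : Prop :=
  IsClosed (S : Set (M₀.ker)ᗮ) ∧ IsClosed (T : Set (M₀.ker)ᗮ) ∧ IsCompl S T ∧
    ∃ ρ : ℝ, 0 < ρ ∧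
      (∀ u₀ ∈ S, MemWeightedL2 (-ρ) S (projectedSolution h (u₀ : H))) ∧
      (∀ u₀ ∈ T, MemWeightedL2 (-ρ) T (projectedSolution h.reverse (u₀ : H)))

/-- The pencil `(M₀, M₁)` admits a mild exponential dichotomy. -/
def AdmitsMildExpDichotomy {M₀ M₁ : H →L[ℂ] H} {μ : ℝ}
    (h : IsAdmissibleRadius M₀ M₁ μ) : Prop :=
  ∃ S T : Submodule ℂ (M₀.ker)ᗮ, IsMildExpDichotomy h S T

/-- The pencil `(M₀, M₁)` is mildly exponentially stable: it admits a mild exponential dichotomy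
with `S = N(M₀)ᗮ` and `T = {0}`. -/
def IsMildlyExpStable {M₀ M₁ : H →L[ℂ] H} {μ : ℝ}
    (h : IsAdmissibleRadius M₀ M₁ μ) : Prop :=
  IsMildExpDichotomy h ⊤ ⊥

end Dichotomy

/-! On E = N(M₀)ᗮ the pencil is a resolvent in disguise. Fix x outside the spectrum and let a be the
restriction of M(x)⁻¹M₀ to E and p the orthogonal projection onto E. Since M₀p = M₀, one has
M(x)⁻¹M(z) = 1 + (z - x) a p. Closed range makes M₀ bounded below on E, and together with the
resolvent bound on a half plane this forces p a to be invertible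
(`IsRegularPencil.exists_isUnit_compression`). With W = (p a)⁻¹, L = x - W and Γ = a W, the operator
M(z) is invertible exactly when z - L is, M(z)⁻¹M₀u = Γ(z - L)⁻¹p u, and p Γ = 1
(`IsRegularPencil.exists_generator`). Inverting the Laplace transform identifies the projected mild
solution with the orbit exp(tL)u, t > 0, for u in E (`solutionOperator_ae_eq`). The reversed pencil
gives -L in the same way, so the theorem becomes one about the bounded operator L.

If L has no spectrum on the imaginary axis, a Riesz projection Q splits E into a part decaying under
exp(tL) and a part decaying under exp(-tL) (`exists_exponential_splitting`). The contour is the unit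
circle seen through a Cayley transform, so the whole imaginary axis, including infinity, is compact.
That Q is idempotent follows from decay: an orbit of Q(1 - Q) decays in both directions, its Fourier
transform is annihilated by the invertible operators z - L, and so it is zero
(`eq_zero_of_norm_exp_mul_le`).

Conversely, Laplace transforms of the decaying orbits invert z - L on S and, with signs reversed, on
T. Both subspaces are L-invariant and an eigenvector on the axis has no decaying orbit, so z - L is
bijective (`IsOrbitDichotomy.isUnit`). -/

/-! ### Riesz-type integrals over the Cayley circle -/

section CayleyIntegral

variable {A : Type*} [NormedRing A] [NormedAlgebra ℂ A] [CompleteSpace A]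

/-- The pencil obtained from `w • 1 - L` by the Cayley transform `w = (z + 1) / (z - 1)`, which
maps the unit disc to the left half plane. -/
def cayleyPencil (L : A) (z : ℂ) : A := (z - 1) • L - (z + 1) • 1

/-- The integral of the inverse of the Cayley pencil over the unit circle. -/
noncomputable def cayleyIntegral (L : A) : A :=
  ∮ z in C(0, 1), Ring.inverse (cayleyPencil L z)

/-- The sign of ‖z‖ - 1 decides the half plane of the image: inside the disc is left, the circle is
the imaginary axis. -/
theorem cayley_re (z : ℂ) :
    ((z + 1) / (z - 1)).re = (‖z‖ ^ 2 - 1) / ‖z - 1‖ ^ 2 := by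
  rw [Complex.div_re, ← Complex.normSq_eq_norm_sq, ← Complex.normSq_eq_norm_sq, ← add_div]
  congr 1
  simp [Complex.normSq_apply]
  ring

omit [CompleteSpace A] in
theorem isUnit_smul_of_ne_zero {c : ℂ} (hc : c ≠ 0) {a : A} (ha : IsUnit a) : IsUnit (c • a) := by
  rw [Algebra.smul_def]
  exact ((isUnit_iff_ne_zero.mpr hc).map (algebraMap ℂ A)).mul ha

omit [CompleteSpace A] in
theorem inverse_smul_of_isUnit {c : ℂ} (hc : c ≠ 0) {a : A} (ha : IsUnit a) :
    Ring.inverse (c • a) = c⁻¹ • Ring.inverse a := by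
  rw [← mul_one (Ring.inverse (c • a)),
    Ring.inverse_mul_eq_iff_eq_mul _ _ _ (isUnit_smul_of_ne_zero hc ha), smul_mul_smul_comm,
    mul_inv_cancel₀ hc, one_smul, Ring.mul_inverse_cancel _ ha]

omit [CompleteSpace A] in
theorem isUnit_neg_two_smul_one : IsUnit ((-2 : ℂ) • (1 : A)) := by
  exact isUnit_smul_of_ne_zero (by norm_num) isUnit_one

-- Away from z = 1 the pencil is a nonzero multiple of w - L. The point z = 1 corresponds to w = ∞,
-- where the pencil is the scalar -2, so infinity causes no singularity.
omit [CompleteSpace A] in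
theorem isUnit_cayleyPencil {L : A} {z : ℂ}
    (h : z ≠ 1 → IsUnit (((z + 1) / (z - 1)) • (1 : A) - L)) : IsUnit (cayleyPencil L z) := by
  by_cases hz : z = 1
  · subst hz
    have : cayleyPencil L 1 = (-2 : ℂ) • (1 : A) := by
      simp only [cayleyPencil, sub_self, zero_smul, zero_sub, ← neg_smul]
      norm_num
    rw [this]
    exact isUnit_neg_two_smul_one
  · have hz' : z - 1 ≠ 0 := sub_ne_zero.mpr hz
    have h1 : cayleyPencil L z = (-(z - 1)) • (((z + 1) / (z - 1)) • (1 : A) - L) := by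
      rw [cayleyPencil, smul_sub, smul_smul, neg_mul, mul_div_cancel₀ _ hz', neg_smul, neg_smul]
      abel
    rw [h1]
    exact isUnit_smul_of_ne_zero (neg_ne_zero.mpr hz') (h hz)

omit [CompleteSpace A] in
theorem continuous_cayleyPencil (L : A) : Continuous (cayleyPencil L) := by
  unfold cayleyPencil; fun_prop

theorem differentiableAt_inverse_cayleyPencil {L : A} {z : ℂ} (h : IsUnit (cayleyPencil L z)) :
    DifferentiableAt ℂ (fun z => Ring.inverse (cayleyPencil L z)) z := by
  have h1 : DifferentiableAt ℂ (cayleyPencil L) z := by unfold cayleyPencil; fun_prop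
  obtain ⟨u, hu⟩ := h
  have h2 : DifferentiableAt ℂ Ring.inverse (cayleyPencil L z) := by
    rw [← hu]
    exact (hasFDerivAt_ringInverse (𝕜 := ℂ) u).differentiableAt
  exact h2.comp z h1

/-- If the Cayley pencil is invertible on the unit circle, then also on an annulus inside. -/
theorem exists_annulus_isUnit {L : A} (h : ∀ z : ℂ, ‖z‖ = 1 → IsUnit (cayleyPencil L z)) :
    ∃ r : ℝ, 0 < r ∧ r < 1 ∧ ∀ z : ℂ, r ≤ ‖z‖ → ‖z‖ ≤ 1 → IsUnit (cayleyPencil L z) := by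
  have hopen : IsOpen {z : ℂ | IsUnit (cayleyPencil L z)} :=
    Units.isOpen.preimage (continuous_cayleyPencil L)
  obtain ⟨δ, hδ, hsub⟩ := (isCompact_sphere (0 : ℂ) 1).exists_thickening_subset_open hopen
    (fun z hz => h z (by simpa using hz))
  -- The bound 1/2 keeps z away from 0, so that z/‖z‖ makes sense; the bound 1 - δ/2 puts z within δ
  -- of that point of the circle.
  refine ⟨max (1 / 2) (1 - δ / 2), by positivity, by
    rw [max_lt_iff]; constructor <;> linarith, fun z hz1 hz2 => hsub ?_⟩
  rw [max_le_iff] at hz1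
  have hz0 : 0 < ‖z‖ := by linarith [hz1.1]
  rw [Metric.mem_thickening_iff]
  refine ⟨(‖z‖⁻¹ : ℝ) • z, ?_, ?_⟩
  · rw [mem_sphere_zero_iff_norm, norm_smul, norm_inv, norm_norm, inv_mul_cancel₀ hz0.ne']
  · have h1 : z - (‖z‖⁻¹ : ℝ) • z = (1 - ‖z‖⁻¹) • z := by rw [sub_smul, one_smul]
    rw [dist_eq_norm, h1, norm_smul, Real.norm_eq_abs]
    have h2 : |1 - ‖z‖⁻¹| = ‖z‖⁻¹ - 1 := by
      rw [abs_sub_comm, abs_of_nonneg]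
      linarith [(one_le_inv₀ hz0).mpr hz2]
    rw [h2, sub_mul, inv_mul_cancel₀ hz0.ne']
    linarith [hz1.2]

/-- Cauchy's theorem on the annulus. The smaller circle avoids z = 1, so its image is a compact
curve strictly inside the left half plane. -/
theorem circleIntegral_cayleyPencil_eq {L : A} {r : ℝ} (hr0 : 0 < r) (hr1 : r < 1)
    (h : ∀ z : ℂ, r ≤ ‖z‖ → ‖z‖ ≤ 1 → IsUnit (cayleyPencil L z)) :
    cayleyIntegral L = ∮ z in C(0, r), Ring.inverse (cayleyPencil L z) := by
  have hd : ∀ z : ℂ, r ≤ ‖z‖ → ‖z‖ ≤ 1 →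
      DifferentiableAt ℂ (fun z : ℂ => z • Ring.inverse (cayleyPencil L z)) z := fun z h1 h2 =>
    differentiableAt_id.smul (differentiableAt_inverse_cayleyPencil (h z h1 h2))
  -- The extra factor z cancels the kernel z⁻¹ of the annulus formula.
  have key := Complex.circleIntegral_sub_center_inv_smul_eq_of_differentiable_on_annulus_off_countable
    (c := 0) hr0 hr1.le (f := fun z : ℂ => z • Ring.inverse (cayleyPencil L z)) (s := ∅)
    Set.countable_empty
    (fun z hz => (hd z (by simpa using hz.2) (by simpa using hz.1)).continuousAt.continuousWithinAt)
    (fun z hz => hd z (by simpa using (not_le.mp (by simpa using hz.1.2)).le)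
      (by simpa using (Metric.mem_ball.mp hz.1.1).le))
  have hs : ∀ R : ℝ, 0 < R → (∮ z in C(0, R), (z - 0)⁻¹ • z • Ring.inverse (cayleyPencil L z)) =
      ∮ z in C(0, R), Ring.inverse (cayleyPencil L z) := by
    intro R hR
    refine circleIntegral.integral_congr hR.le fun z hz => ?_
    have hz0 : z ≠ 0 := by
      rintro rfl
      simp at hz
      exact hR.ne hz
    simp [smul_smul, inv_mul_cancel₀ hz0]
  rw [hs 1 one_pos, hs r hr0] at key
  exact key

theorem mul_circleIntegral (a : A) {f : ℂ → A} {r : ℝ} (hf : CircleIntegrable f 0 r) :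
    a * (∮ z in C(0, r), f z) = ∮ z in C(0, r), a * f z := by
  simp only [circleIntegral]
  have h := (ContinuousLinearMap.mul ℂ A a).intervalIntegral_comp_comm hf.out
  simp only [ContinuousLinearMap.mul_apply'] at h
  rw [← h]
  simp only [mul_smul_comm]

omit [CompleteSpace A] in
theorem hasDerivAt_circleIntegral_exp_smul {r : ℝ} (hr : 0 ≤ r) {g : ℂ → ℂ} {G : ℂ → A}
    (hg : ContinuousOn g (Metric.sphere 0 r)) (hG : ContinuousOn G (Metric.sphere 0 r)) (t : ℝ) :
    HasDerivAt (fun t : ℝ => ∮ z in C(0, r), Complex.exp (t * g z) • G z)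
      (∮ z in C(0, r), (Complex.exp (t * g z) * g z) • G z) t := by
  have hm : ∀ θ : ℝ, circleMap 0 r θ ∈ Metric.sphere (0 : ℂ) r := circleMap_mem_sphere 0 hr
  have hg' : Continuous fun θ => g (circleMap 0 r θ) :=
    hg.comp_continuous (continuous_circleMap 0 r) hm
  have hG' : Continuous fun θ => G (circleMap 0 r θ) :=
    hG.comp_continuous (continuous_circleMap 0 r) hm
  have hF' : Continuous fun p : ℝ × ℝ => deriv (circleMap 0 r) p.2 •
      (Complex.exp (p.1 * g (circleMap 0 r p.2)) * g (circleMap 0 r p.2)) •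
        G (circleMap 0 r p.2) := by
    simp only [deriv_circleMap]
    have h1 : Continuous fun p : ℝ × ℝ => g (circleMap 0 r p.2) := hg'.comp continuous_snd
    have h2 : Continuous fun p : ℝ × ℝ => G (circleMap 0 r p.2) := hG'.comp continuous_snd
    have h3 : Continuous fun p : ℝ × ℝ => circleMap 0 r p.2 :=
      (continuous_circleMap 0 r).comp continuous_snd
    exact (h3.mul continuous_const).smul
      ((((Complex.continuous_ofReal.comp continuous_fst).mul h1).cexp.mul h1).smul h2)
  have hF : ∀ t : ℝ, Continuous fun θ : ℝ => deriv (circleMap 0 r) θ •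
      Complex.exp (t * g (circleMap 0 r θ)) • G (circleMap 0 r θ) := by
    intro t
    simp only [deriv_circleMap]
    exact ((continuous_circleMap 0 r).mul continuous_const).smul
      ((continuous_const.mul hg').cexp.smul hG')
  obtain ⟨C, hC⟩ := ((isCompact_closedBall t 1).prod
    (isCompact_Icc (a := (0 : ℝ)) (b := 2 * Real.pi))).exists_bound_of_continuousOn hF'.continuousOn
  refine (intervalIntegral.hasDerivAt_integral_of_dominated_loc_of_deriv_le
    (a := 0) (b := 2 * Real.pi) (μ := volume)
    (F := fun (t : ℝ) θ => deriv (circleMap 0 r) θ •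
      Complex.exp (t * g (circleMap 0 r θ)) • G (circleMap 0 r θ))
    (F' := fun (t : ℝ) θ => deriv (circleMap 0 r) θ •
      (Complex.exp (t * g (circleMap 0 r θ)) * g (circleMap 0 r θ)) • G (circleMap 0 r θ))
    (s := Metric.closedBall t 1) (bound := fun _ => C) (Metric.closedBall_mem_nhds t one_pos)
    (Filter.Eventually.of_forall fun s => (hF s).aestronglyMeasurable)
    ((hF t).intervalIntegrable _ _) ?_ ?_ (_root_.intervalIntegrable_const (μ := volume)) ?_).2
  · exact (hF'.comp (Continuous.prodMk_right t)).aestronglyMeasurable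
  · refine Filter.Eventually.of_forall fun θ hθ s hs => hC (s, θ) ⟨hs, ?_⟩
    rw [Set.uIoc_of_le (by positivity)] at hθ
    exact ⟨hθ.1.le, hθ.2⟩
  · refine Filter.Eventually.of_forall fun θ _ s _ => ?_
    have h1 : HasDerivAt (fun s : ℝ => Complex.exp ((s : ℂ) * g (circleMap 0 r θ)))
        (Complex.exp (s * g (circleMap 0 r θ)) * g (circleMap 0 r θ)) s := by
      have := ((hasDerivAt_id (s : ℂ)).mul_const (g (circleMap 0 r θ))).cexp.comp_ofReal
      simpa using this
    exact (h1.smul_const (G (circleMap 0 r θ))).const_smul (deriv (circleMap 0 r) θ)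

/-- Uniqueness for J' = L J: the product exp(-tL) J(t) has derivative zero. -/
theorem exp_smul_mul_of_hasDerivAt {L : A} {J : ℝ → A} (h : ∀ t, HasDerivAt J (L * J t) t)
    (t : ℝ) : NormedSpace.exp (t • L) * J 0 = J t := by
  let _ : NormedAlgebra ℚ A := NormedAlgebra.restrictScalars ℚ ℂ A
  have hd : ∀ s, HasDerivAt (fun s : ℝ => NormedSpace.exp (s • (-L)) * J s) 0 s := by
    intro s
    have := (hasDerivAt_exp_smul_const (-L) s).mul (h s)
    have h0 : NormedSpace.exp (s • -L) * -L * J s + NormedSpace.exp (s • -L) * (L * J s) = 0 := by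
      rw [← mul_assoc, ← add_mul]
      simp
    rwa [h0] at this
  have hc : NormedSpace.exp (t • (-L)) * J t = J 0 := by
    have := is_const_of_deriv_eq_zero (fun s => (hd s).differentiableAt) (fun s => (hd s).deriv) t 0
    simpa using this
  rw [← hc, ← mul_assoc, ← NormedSpace.exp_add_of_commute]
  · simp
  · exact ((Commute.refl L).neg_right.smul_left t).smul_right t

/-- Exponential decay of `exp (t L)` on the range of the Cayley integral. -/
theorem exists_norm_exp_mul_cayleyIntegral_le {L : A}
    (h : ∀ z : ℂ, z.re = 0 → IsUnit (z • (1 : A) - L)) :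
    ∃ ρ C : ℝ, 0 < ρ ∧ ∀ t : ℝ, 0 ≤ t →
      ‖NormedSpace.exp (t • L) * cayleyIntegral L‖ ≤ C * Real.exp (-ρ * t) := by
  have hcirc : ∀ z : ℂ, ‖z‖ = 1 → IsUnit (cayleyPencil L z) := fun z hz =>
    isUnit_cayleyPencil fun _ => h _ (by rw [cayley_re, hz]; simp)
  obtain ⟨r, hr0, hr1, hr⟩ := exists_annulus_isUnit hcirc
  set g : ℂ → ℂ := fun z => (z + 1) / (z - 1) with hgdef
  set G : ℂ → A := fun z => Ring.inverse (cayleyPencil L z) with hGdef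
  have hne : ∀ z : ℂ, ‖z‖ ≤ r → z - 1 ≠ 0 := by
    intro z hz h0
    rw [sub_eq_zero.mp h0, norm_one] at hz
    linarith
  have hgd : ∀ z : ℂ, ‖z‖ ≤ r → DifferentiableAt ℂ g z := fun z hz =>
    (differentiableAt_id.add_const _).div (differentiableAt_id.sub_const _) (hne z hz)
  have hu : ∀ z ∈ Metric.sphere (0 : ℂ) r, IsUnit (cayleyPencil L z) := by
    intro z hz
    rw [mem_sphere_zero_iff_norm] at hz
    exact hr z hz.ge (hz.trans_le hr1.le)
  have hgc : ContinuousOn g (Metric.sphere 0 r) := fun z hz =>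
    (hgd z (by simpa using (mem_sphere_zero_iff_norm.mp hz).le)).continuousAt.continuousWithinAt
  have hGc : ContinuousOn G (Metric.sphere 0 r) := fun z hz =>
    (differentiableAt_inverse_cayleyPencil (hu z hz)).continuousAt.continuousWithinAt
  -- This is the contour formula for exp(tL) times the Cayley integral; it satisfies J' = L J, which
  -- proves that claim without a functional calculus.
  set J : ℝ → A := fun t => ∮ z in C(0, r), Complex.exp (t * g z) • G z with hJ
  have hid : ∀ z ∈ Metric.sphere (0 : ℂ) r, g z • G z = L * G z - (z - 1)⁻¹ • (1 : A) := by
    intro z hz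
    have h1 : cayleyPencil L z * G z = 1 := Ring.mul_inverse_cancel _ (hu z hz)
    have h0 := hne z (mem_sphere_zero_iff_norm.mp hz).le
    rw [cayleyPencil, sub_mul, smul_mul_assoc, smul_mul_assoc, one_mul] at h1
    rw [← h1, smul_sub, smul_smul, smul_smul, inv_mul_cancel₀ h0, one_smul, sub_sub_cancel,
      ← div_eq_inv_mul]
  have hexpc : ∀ t : ℝ, ContinuousOn (fun z => Complex.exp (t * g z)) (Metric.sphere 0 r) :=
    fun t => (continuousOn_const.mul hgc).cexp
  have hderiv : ∀ t, HasDerivAt J (L * J t) t := by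
    intro t
    have h1 := hasDerivAt_circleIntegral_exp_smul hr0.le hgc hGc t
    convert h1 using 1
    have h2 : (∮ z in C(0, r), (Complex.exp (t * g z) * g z) • G z) =
        ∮ z in C(0, r), (L * (Complex.exp (t * g z) • G z) -
          (Complex.exp (t * g z) * (z - 1)⁻¹) • (1 : A)) := by
      refine circleIntegral.integral_congr hr0.le fun z hz => ?_
      simp only [mul_smul, hid z hz, smul_sub, mul_smul_comm]
    -- The discrepancy between g G and L G no longer involves the resolvent, so it is holomorphic on
    -- the disc of radius r < 1 and integrates to zero.
    have h3 : DifferentiableOn ℂ (fun z => (Complex.exp (t * g z) * (z - 1)⁻¹) • (1 : A))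
        (Metric.closedBall 0 r) := fun z hz => by
      have hz' : ‖z‖ ≤ r := by simpa using hz
      exact ((((hgd z hz').const_mul _).cexp.mul
        ((differentiableAt_id.sub_const _).inv (hne z hz'))).smul_const _).differentiableWithinAt
    have h4 : (∮ z in C(0, r), (Complex.exp (t * g z) * (z - 1)⁻¹) • (1 : A)) = 0 :=
      Complex.circleIntegral_eq_zero_of_differentiable_on_off_countable hr0.le
        Set.countable_empty h3.continuousOn fun z hz =>
          h3.differentiableAt (Metric.closedBall_mem_nhds_of_mem hz.1)
    have h5 : CircleIntegrable (fun z => L * (Complex.exp (t * g z) • G z)) 0 r :=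
      (continuousOn_const.mul ((hexpc t).smul hGc)).circleIntegrable hr0.le
    have h6 : CircleIntegrable (fun z => (Complex.exp (t * g z) * (z - 1)⁻¹) • (1 : A)) 0 r :=
      (h3.continuousOn.mono Metric.sphere_subset_closedBall).circleIntegrable hr0.le
    rw [h2, circleIntegral.integral_sub h5 h6, h4, sub_zero, hJ]
    exact mul_circleIntegral L (((hexpc t).smul hGc).circleIntegrable hr0.le)
  have hJ0 : J 0 = cayleyIntegral L := by
    rw [circleIntegral_cayleyPencil_eq hr0 hr1 hr, hJ]
    simp [hGdef]
  obtain ⟨C, hC⟩ := (isCompact_sphere (0 : ℂ) r).exists_bound_of_continuousOn hGc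
  -- From `cayley_re` with ‖z‖ = r and ‖z - 1‖ ≤ 2.
  set ρ : ℝ := (1 - r ^ 2) / 4 with hρ
  have hρ0 : 0 < ρ := by
    rw [hρ]; nlinarith
  have hre : ∀ z ∈ Metric.sphere (0 : ℂ) r, (g z).re ≤ -ρ := by
    intro z hz
    rw [mem_sphere_zero_iff_norm] at hz
    have h0 : 0 < ‖z - 1‖ := norm_pos_iff.mpr (hne z hz.le)
    have h1 : ‖z - 1‖ ≤ 2 := by
      have := norm_sub_le z 1
      rw [norm_one] at this
      linarith
    rw [hgdef]
    simp only
    rw [cayley_re, hz, div_le_iff₀ (by positivity), hρ]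
    have h2 : ‖z - 1‖ ^ 2 ≤ 4 := by nlinarith
    nlinarith
  refine ⟨ρ, 2 * Real.pi * r * |C|, hρ0, fun t ht => ?_⟩
  rw [← hJ0, exp_smul_mul_of_hasDerivAt hderiv t]
  have := circleIntegral.norm_integral_le_of_norm_le_const (c := 0) hr0.le
    (f := fun z => Complex.exp (t * g z) • G z) (C := Real.exp (-ρ * t) * |C|) fun z hz => by
      rw [norm_smul, Complex.norm_exp, Complex.re_ofReal_mul]
      have h1 := hre z hz
      have h2 := (hC z hz).trans (le_abs_self C)
      have h3 : t * (g z).re ≤ -ρ * t := by nlinarith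
      exact mul_le_mul (Real.exp_le_exp.mpr h3) h2 (norm_nonneg _) (Real.exp_pos _).le
  refine this.trans (le_of_eq ?_)
  ring

/-- The Cayley integral vanishes if `-L` has its spectrum in the open left half plane. -/
theorem cayleyIntegral_eq_zero {L : A} (h : ∀ z : ℂ, z.re ≤ 0 → IsUnit (z • (1 : A) - L)) :
    cayleyIntegral L = 0 := by
  have hd : ∀ z : ℂ, ‖z‖ ≤ 1 →
      DifferentiableAt ℂ (fun z => Ring.inverse (cayleyPencil L z)) z := fun z hz =>
    differentiableAt_inverse_cayleyPencil <| isUnit_cayleyPencil fun _ => h _ (by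
      rw [cayley_re]
      exact div_nonpos_of_nonpos_of_nonneg (by nlinarith [norm_nonneg z]) (by positivity))
  exact Complex.circleIntegral_eq_zero_of_differentiable_on_off_countable zero_le_one
    Set.countable_empty (fun z hz => (hd z (by simpa using hz)).continuousAt.continuousWithinAt)
    fun z hz => hd z (by simpa using (Metric.mem_ball.mp hz.1).le)

-- The inversion z ↦ z⁻¹ of the circle turns w into -w, exchanging the roles of the two half planes.
omit [CompleteSpace A] in
theorem cayleyIntegral_neg {L : A} (h : ∀ z : ℂ, ‖z‖ = 1 → IsUnit (cayleyPencil L z)) :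
    cayleyIntegral (-L) = ∮ z in C(0, 1), z⁻¹ • Ring.inverse (cayleyPencil L z) := by
  have hmap : ∀ θ : ℝ, circleMap 0 1 (2 * Real.pi - θ) = (circleMap 0 1 θ)⁻¹ := by
    intro θ
    simp only [circleMap_zero, Complex.ofReal_one, one_mul, ← Complex.exp_neg]
    push_cast
    rw [sub_mul, Complex.exp_sub, Complex.exp_two_pi_mul_I, one_div, Complex.exp_neg]
  rw [cayleyIntegral, circleIntegral, circleIntegral]
  have h1 := intervalIntegral.integral_comp_sub_left (a := 0) (b := 2 * Real.pi) (fun θ : ℝ =>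
    deriv (circleMap 0 1) θ • Ring.inverse (cayleyPencil (-L) (circleMap 0 1 θ))) (2 * Real.pi)
  rw [sub_self, sub_zero] at h1
  rw [← h1]
  refine intervalIntegral.integral_congr fun θ _ => ?_
  simp only [deriv_circleMap, hmap]
  set z := circleMap 0 1 θ with hz
  have hz1 : ‖z‖ = 1 := by simp [hz]
  have hz0 : z ≠ 0 := by
    rw [← norm_ne_zero_iff, hz1]
    exact one_ne_zero
  have h2 : cayleyPencil (-L) z⁻¹ = z⁻¹ • cayleyPencil L z := by
    simp only [cayleyPencil, smul_neg, ← neg_smul, smul_sub, smul_smul]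
    congr 2 <;> field_simp <;> ring
  rw [h2, inverse_smul_of_isUnit (inv_ne_zero hz0) (h z hz1), inv_inv, smul_smul, smul_smul]
  congr 1
  field_simp

/-- After the inversion the two integrands add up to z⁻¹ times the Cayley pencil times its inverse,
that is to z⁻¹. This is the complementarity of the two spectral projections. -/
theorem cayleyIntegral_add_cayleyIntegral_neg {L : A}
    (h : ∀ z : ℂ, z.re = 0 → IsUnit (z • (1 : A) - L)) :
    (L - 1) * cayleyIntegral L + (-L - 1) * cayleyIntegral (-L) =
      (2 * Real.pi * Complex.I : ℂ) • 1 := by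
  have hcirc : ∀ z : ℂ, ‖z‖ = 1 → IsUnit (cayleyPencil L z) := fun z hz =>
    isUnit_cayleyPencil fun _ => h _ (by rw [cayley_re, hz]; simp)
  have hz0 : ∀ z ∈ Metric.sphere (0 : ℂ) 1, z ≠ 0 := by
    rintro z hz rfl
    simp at hz
  have hG : ContinuousOn (fun z => Ring.inverse (cayleyPencil L z)) (Metric.sphere (0 : ℂ) 1) :=
    fun z hz => (differentiableAt_inverse_cayleyPencil
      (hcirc z (by simpa using hz))).continuousAt.continuousWithinAt
  have hG' : ContinuousOn (fun z => z⁻¹ • Ring.inverse (cayleyPencil L z))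
      (Metric.sphere (0 : ℂ) 1) :=
    (continuousOn_id.inv₀ hz0).smul hG
  rw [cayleyIntegral_neg hcirc, cayleyIntegral, mul_circleIntegral _ (hG.circleIntegrable zero_le_one),
    mul_circleIntegral _ (hG'.circleIntegrable zero_le_one)]
  have hi : CircleIntegrable (fun z => (L - 1) * Ring.inverse (cayleyPencil L z)) 0 1 :=
    (continuousOn_const.mul hG).circleIntegrable zero_le_one
  have hi' : CircleIntegrable (fun z => (-L - 1) * z⁻¹ • Ring.inverse (cayleyPencil L z)) 0 1 :=
    (continuousOn_const.mul hG').circleIntegrable zero_le_one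
  rw [← circleIntegral.integral_add hi hi']
  have h1 : ∀ z ∈ Metric.sphere (0 : ℂ) 1, (L - 1) * Ring.inverse (cayleyPencil L z) +
      (-L - 1) * z⁻¹ • Ring.inverse (cayleyPencil L z) = (z - 0)⁻¹ • (1 : A) := by
    intro z hz
    have h2 := Ring.mul_inverse_cancel _ (hcirc z (by simpa using hz))
    have h3 : (L - 1) + z⁻¹ • (-L - 1) = z⁻¹ • cayleyPencil L z := by
      simp only [cayleyPencil, smul_sub, smul_neg, smul_smul, sub_smul, smul_add, add_smul,
        inv_mul_cancel₀ (hz0 z hz), one_smul]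
      abel
    rw [sub_zero, mul_smul_comm, ← smul_mul_assoc, ← add_mul, h3, smul_mul_assoc, h2]
  rw [circleIntegral.integral_congr zero_le_one h1, circleIntegral.integral_smul_const,
    circleIntegral.integral_sub_center_inv _ one_ne_zero]

end CayleyIntegral

/-! ### Spectral projection and exponential splitting -/

section ExponentialSplitting

variable {A : Type*} [NormedRing A] [NormedAlgebra ℂ A] [CompleteSpace A]

theorem hasDerivAt_exp_smul_mul (L w : A) (t : ℝ) :
    HasDerivAt (fun t : ℝ => NormedSpace.exp (t • L) * w) (L * (NormedSpace.exp (t • L) * w)) t := by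
  have := (hasDerivAt_exp_smul_const' L t).mul_const w
  rwa [mul_assoc] at this

theorem commute_circleIntegral {a : A} {f : ℂ → A} {r : ℝ} (hf : CircleIntegrable f 0 r)
    (hr : 0 ≤ r) (h : ∀ z ∈ Metric.sphere (0 : ℂ) r, Commute a (f z)) :
    Commute a (∮ z in C(0, r), f z) := by
  have h1 : (∮ z in C(0, r), f z) * a = ∮ z in C(0, r), f z * a := by
    simp only [circleIntegral]
    have h := ((ContinuousLinearMap.mul ℂ A).flip a).intervalIntegral_comp_comm hf.out
    simp only [ContinuousLinearMap.flip_apply, ContinuousLinearMap.mul_apply'] at h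
    rw [← h]
    simp only [smul_mul_assoc]
  rw [Commute, SemiconjBy, h1, mul_circleIntegral a hf]
  exact circleIntegral.integral_congr hr fun z hz => h z hz

/-- The integrand is the inverse of a polynomial in L, so L commutes with it pointwise on the
circle. -/
theorem commute_cayleyIntegral {L : A} (h : ∀ z : ℂ, z.re = 0 → IsUnit (z • (1 : A) - L)) :
    Commute L (cayleyIntegral L) := by
  have hcirc : ∀ z ∈ Metric.sphere (0 : ℂ) 1, IsUnit (cayleyPencil L z) := fun z hz =>
    isUnit_cayleyPencil fun _ => h _ (by
      rw [cayley_re, mem_sphere_zero_iff_norm.mp hz]; simp)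
  refine commute_circleIntegral (ContinuousOn.circleIntegrable zero_le_one fun z hz =>
    (differentiableAt_inverse_cayleyPencil (hcirc z hz)).continuousAt.continuousWithinAt)
    zero_le_one fun z hz => ?_
  have h1 : Commute L (cayleyPencil L z) :=
    ((Commute.refl L).smul_right _).sub_right ((Commute.one_right L).smul_right _)
  obtain ⟨u, hu⟩ := hcirc z hz
  rw [← hu] at h1 ⊢
  rw [Ring.inverse_unit]
  exact h1.units_inv_right

theorem integrable_exp_neg_mul_abs {ρ : ℝ} (hρ : 0 < ρ) :
    Integrable fun t : ℝ => Real.exp (-ρ * |t|) := by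
  rw [← integrableOn_univ, ← Set.Iic_union_Ioi (a := (0 : ℝ)), integrableOn_union]
  constructor
  · refine (integrableOn_exp_mul_Iic hρ 0).congr_fun (fun t ht => ?_) measurableSet_Iic
    simp [abs_of_nonpos (Set.mem_Iic.mp ht)]
  · refine (integrableOn_exp_mul_Ioi (neg_lt_zero.mpr hρ) 0).congr_fun (fun t ht => ?_)
      measurableSet_Ioi
    simp [abs_of_pos (Set.mem_Ioi.mp ht)]

/-- An orbit that decays exponentially in both time directions vanishes if there is no spectrum on
the imaginary axis. -/
theorem eq_zero_of_norm_exp_mul_le {L w : A} (h : ∀ z : ℂ, z.re = 0 → IsUnit (z • (1 : A) - L))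
    {ρ C : ℝ} (hρ : 0 < ρ)
    (hpos : ∀ t : ℝ, 0 ≤ t → ‖NormedSpace.exp (t • L) * w‖ ≤ C * Real.exp (-ρ * t))
    (hneg : ∀ t : ℝ, 0 ≤ t → ‖NormedSpace.exp (t • (-L)) * w‖ ≤ C * Real.exp (-ρ * t)) :
    w = 0 := by
  set f : ℝ → A := fun t => NormedSpace.exp (t • L) * w with hf
  have hfd : ∀ t, HasDerivAt f (L * f t) t := hasDerivAt_exp_smul_mul L w
  have hfc : Continuous f := continuous_iff_continuousAt.mpr fun t => (hfd t).continuousAt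
  have hfb : ∀ t, ‖f t‖ ≤ C * Real.exp (-ρ * |t|) := by
    intro t
    rcases le_total 0 t with ht | ht
    · rw [abs_of_nonneg ht]; exact hpos t ht
    · have := hneg (-t) (by linarith)
      rw [neg_smul_neg] at this
      rwa [abs_of_nonpos ht]
  have hfi : Integrable f := ((integrable_exp_neg_mul_abs hρ).const_mul C).mono'
    hfc.aestronglyMeasurable (Filter.Eventually.of_forall hfb)
  have hF : FourierTransform.fourier f = 0 := by
    funext ξ
    rw [Real.fourier_eq']
    set z : ℂ := 2 * Real.pi * ξ * Complex.I with hz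
    set g : ℝ → A := fun t => Complex.exp (-z * t) • f t with hg
    have hgf : ∀ t : ℝ, Complex.exp ((↑(-2 * Real.pi * inner ℝ t ξ) * Complex.I)) • f t = g t := by
      intro t
      rw [hg, hz]
      simp only [RCLike.inner_apply, conj_trivial]
      congr 2
      push_cast
      ring
    have hgn : ∀ t : ℝ, ‖Complex.exp (-z * t)‖ = 1 := by
      intro t
      rw [Complex.norm_exp, hz]
      simp
    have hed : ∀ t : ℝ, HasDerivAt (fun t : ℝ => Complex.exp (-z * t))
        (Complex.exp (-z * t) * -z) t := by
      intro t
      have := ((hasDerivAt_id (t : ℂ)).const_mul (-z)).cexp.comp_ofReal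
      simpa using this
    -- The integral of g' over the line vanishes, so z - L kills the integral of g; invertibility on
    -- the axis makes that integral, the Fourier transform at ξ, zero.
    have hgd : ∀ t, HasDerivAt g (-((z • (1 : A) - L) * g t)) t := by
      intro t
      refine ((hed t).smul (hfd t)).congr_deriv ?_
      simp only [hg, sub_mul, smul_mul_assoc, one_mul, mul_smul_comm, mul_smul, neg_smul, smul_neg]
      rw [smul_sub]
      abel
    have hgi : Integrable g := by
      refine hfi.norm.mono' ?_ (Filter.Eventually.of_forall fun t => ?_)
      · exact (continuous_iff_continuousAt.mpr fun t => (hgd t).continuousAt).aestronglyMeasurable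
      · rw [hg]
        simp only
        rw [norm_smul, hgn, one_mul]
    have hgi' : Integrable fun t => (z • (1 : A) - L) * g t :=
      (ContinuousLinearMap.mul ℂ A (z • (1 : A) - L)).integrable_comp hgi
    have h0 := integral_eq_zero_of_hasDerivAt_of_integrable hgd hgi'.neg hgi
    rw [integral_neg, neg_eq_zero] at h0
    have h1 : (z • (1 : A) - L) * ∫ t, g t = 0 := by
      rw [← h0]
      exact ((ContinuousLinearMap.mul ℂ A (z • (1 : A) - L)).integral_comp_comm hgi).symm
    have hu := h z (by rw [hz]; simp)
    refine (integral_congr_ae (Filter.Eventually.of_forall hgf)).trans ?_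
    exact (hu.mul_right_eq_zero).mp h1
  have hinv := hfi.fourierInv_fourier_eq (by rw [hF]; exact integrable_zero _ _ _)
    (hfc.continuousAt (x := 0))
  rw [hF] at hinv
  have h0 : f 0 = w := by simp [hf]
  rw [← h0, ← hinv, Real.fourierInv_eq']
  simp

/-- The spectral splitting of an operator without spectrum on the imaginary axis. -/
theorem exists_exponential_splitting {L : A}
    (h : ∀ z : ℂ, z.re = 0 → IsUnit (z • (1 : A) - L)) :
    ∃ (Q : A) (ρ C : ℝ), 0 < ρ ∧ Commute L Q ∧ Q * Q = Q ∧
      (∀ t : ℝ, 0 ≤ t → ‖NormedSpace.exp (t • L) * Q‖ ≤ C * Real.exp (-ρ * t)) ∧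
      (∀ t : ℝ, 0 ≤ t → ‖NormedSpace.exp (t • (-L)) * (1 - Q)‖ ≤ C * Real.exp (-ρ * t)) ∧
      ((∀ z : ℂ, 0 ≤ z.re → IsUnit (z • (1 : A) - L)) → Q = 1) := by
  have hneg : ∀ z : ℂ, IsUnit (-z • (1 : A) - L) → IsUnit (z • (1 : A) - -L) := by
    intro z hz
    have h2 : z • (1 : A) - -L = -(-z • (1 : A) - L) := by
      rw [neg_smul]; abel
    rw [h2]
    exact hz.neg
  have h' : ∀ z : ℂ, z.re = 0 → IsUnit (z • (1 : A) - -L) := fun z hz =>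
    hneg z (h (-z) (by simpa using hz))
  set c : ℂ := 2 * Real.pi * Complex.I with hc
  have hc0 : c ≠ 0 := by
    rw [hc]
    simp [Real.pi_ne_zero]
  set J := cayleyIntegral L
  set J' := cayleyIntegral (-L)
  -- On the circle of radius r, (L - 1)G equals 2(z - 1)⁻¹G plus the term (z - 1)⁻¹, which
  -- integrates to zero; the first term is the resolvent of L times dw/dz. So Q is the Riesz
  -- projection of the left half plane, in a form with no pole at z = 1.
  set Q : A := c⁻¹ • ((L - 1) * J) with hQ
  have hQ' : 1 - Q = c⁻¹ • ((-L - 1) * J') := by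
    rw [sub_eq_iff_eq_add, hQ, ← smul_add, add_comm, cayleyIntegral_add_cayleyIntegral_neg h,
      smul_smul, inv_mul_cancel₀ hc0, one_smul]
  have hcJ : Commute L J := commute_cayleyIntegral h
  have hcQ : Commute L Q := (((Commute.refl L).sub_right (Commute.one_right L)).mul_right
    hcJ).smul_right _
  obtain ⟨ρ₁, C₁, hρ₁, hb₁⟩ := exists_norm_exp_mul_cayleyIntegral_le h
  obtain ⟨ρ₂, C₂, hρ₂, hb₂⟩ := exists_norm_exp_mul_cayleyIntegral_le h'
  have hmul : ∀ {x w K : A} {C ρ t : ℝ}, Commute x w → ‖x * K‖ ≤ C * Real.exp (-ρ * t) →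
      ‖x * (c⁻¹ • (w * K))‖ ≤ ‖c⁻¹‖ * ‖w‖ * |C| * Real.exp (-ρ * t) := by
    intro x w K C ρ t hxw hK
    rw [mul_smul_comm, norm_smul, ← mul_assoc, hxw.eq, mul_assoc, mul_assoc, mul_assoc]
    gcongr
    refine (norm_mul_le _ _).trans ?_
    gcongr
    exact hK.trans (by gcongr; exact le_abs_self C)
  have hexp : ∀ {a b : A}, Commute a b → Commute (NormedSpace.exp a) b := fun hab => by
    let _ : NormedAlgebra ℚ A := NormedAlgebra.restrictScalars ℚ ℂ A
    exact hab.exp_left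
  set C := max (‖c⁻¹‖ * ‖L - 1‖ * |C₁|) (‖c⁻¹‖ * ‖-L - 1‖ * |C₂|) with hC
  have hC0 : 0 ≤ C := le_max_of_le_left (by positivity)
  set ρ := min ρ₁ ρ₂ with hρ
  have hρ0 : 0 < ρ := lt_min hρ₁ hρ₂
  have hmono : ∀ {D σ t x : ℝ}, 0 ≤ t → D ≤ C → ρ ≤ σ → x ≤ D * Real.exp (-σ * t) →
      x ≤ C * Real.exp (-ρ * t) := by
    intro D σ t x ht hD hσ hx
    refine hx.trans (mul_le_mul hD (Real.exp_le_exp.mpr ?_) (Real.exp_pos _).le hC0)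
    nlinarith
  have hbQ : ∀ t : ℝ, 0 ≤ t → ‖NormedSpace.exp (t • L) * Q‖ ≤ C * Real.exp (-ρ * t) :=
    fun t ht => hmono ht (le_max_left _ _) (min_le_left _ _) (hmul (hexp
      (((Commute.refl L).sub_right (Commute.one_right L)).smul_left t)) (hb₁ t ht))
  have hbQ' : ∀ t : ℝ, 0 ≤ t →
      ‖NormedSpace.exp (t • (-L)) * (1 - Q)‖ ≤ C * Real.exp (-ρ * t) := by
    intro t ht
    rw [hQ']
    exact hmono ht (le_max_right _ _) (min_le_right _ _) (hmul (hexp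
      (((Commute.refl (-L)).sub_right (Commute.one_right (-L))).smul_left t)) (hb₂ t ht))
  -- Forward decay comes from the factor Q, backward decay from 1 - Q, since the two commute.
  have hQQ : Q * (1 - Q) = 0 := by
    refine eq_zero_of_norm_exp_mul_le (C := C * max ‖1 - Q‖ ‖Q‖) h hρ0 (fun t ht => ?_)
      fun t ht => ?_
    · rw [← mul_assoc, mul_right_comm]
      refine (norm_mul_le _ _).trans ?_
      exact mul_le_mul (hbQ t ht) (le_max_left _ _) (norm_nonneg _) (by positivity)
    · have hcomm : Q * (1 - Q) = (1 - Q) * Q := by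
        rw [mul_sub, sub_mul, mul_one, one_mul]
      rw [hcomm, ← mul_assoc, mul_right_comm]
      refine (norm_mul_le _ _).trans ?_
      exact mul_le_mul (hbQ' t ht) (le_max_right _ _) (norm_nonneg _) (by positivity)
  refine ⟨Q, ρ, C, hρ0, hcQ, ?_, hbQ, hbQ', fun hr => ?_⟩
  · rw [mul_sub, mul_one, sub_eq_zero] at hQQ
    exact hQQ.symm
  -- With no spectrum in the closed right half plane, -L has none in the closed left one, so the
  -- complementary projection is zero.
  · have hJ' : J' = 0 := cayleyIntegral_eq_zero fun z hz => hneg z (hr (-z) (by simpa using hz))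
    rw [hJ', mul_zero, smul_zero, sub_eq_zero] at hQ'
    exact hQ'.symm

end ExponentialSplitting

/-! ### Orbits of the group and their Laplace transforms -/

section Orbits

variable {E : Type*} [NormedAddCommGroup E] [InnerProductSpace ℂ E] [CompleteSpace E]

theorem hasDerivAt_exp_smul_apply (L : E →L[ℂ] E) (u : E) (t : ℝ) :
    HasDerivAt (fun t : ℝ => NormedSpace.exp (t • L) u) (L (NormedSpace.exp (t • L) u)) t := by
  have h := hasDerivAt_exp_smul_const' L t
  exact (((ContinuousLinearMap.apply ℂ E u).restrictScalars ℝ).hasFDerivAt.comp_hasDerivAt t h)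

theorem continuous_exp_smul_apply (L : E →L[ℂ] E) (u : E) :
    Continuous fun t : ℝ => NormedSpace.exp (t • L) u :=
  continuous_iff_continuousAt.mpr fun t => (hasDerivAt_exp_smul_apply L u t).continuousAt

theorem hasDerivAt_cexp_smul_exp_smul_apply (L : E →L[ℂ] E) (u : E) (z : ℂ) (t : ℝ) :
    HasDerivAt (fun t : ℝ => Complex.exp (-z * t) • NormedSpace.exp (t • L) u)
      (-((z • (1 : E →L[ℂ] E) - L) (Complex.exp (-z * t) • NormedSpace.exp (t • L) u))) t := by
  have hed : HasDerivAt (fun t : ℝ => Complex.exp (-z * t)) (Complex.exp (-z * t) * -z) t := by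
    have := ((hasDerivAt_id (t : ℂ)).const_mul (-z)).cexp.comp_ofReal
    simpa using this
  refine (hed.smul (hasDerivAt_exp_smul_apply L u t)).congr_deriv ?_
  simp only [sub_apply, smul_apply,
    one_apply_eq_self, map_smul, mul_smul, neg_smul, smul_neg]
  rw [smul_sub]
  abel

/-- The Laplace transform of an orbit is the resolvent. -/
theorem sub_apply_integral_exp (L : E →L[ℂ] E) (u : E) (z : ℂ)
    (hint : IntegrableOn (fun t : ℝ => Complex.exp (-z * t) • NormedSpace.exp (t • L) u)
      (Set.Ioi 0)) :
    (z • (1 : E →L[ℂ] E) - L)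
      (∫ t in Set.Ioi (0 : ℝ), Complex.exp (-z * t) • NormedSpace.exp (t • L) u) = u := by
  have hd := hasDerivAt_cexp_smul_exp_smul_apply L u z
  have hint' := ((z • (1 : E →L[ℂ] E) - L).integrable_comp hint).neg
  -- The integrand and its derivative are both integrable, which already forces the limit zero at
  -- infinity; no pointwise decay is needed.
  have hlim := tendsto_zero_of_hasDerivAt_of_integrableOn_Ioi (fun t _ => hd t) hint' hint
  have h1 := integral_Ioi_of_hasDerivAt_of_tendsto' (a := (0 : ℝ)) (fun t _ => hd t) hint' hlim
  rw [integral_neg, ContinuousLinearMap.integral_comp_comm _ hint, zero_sub, neg_inj] at h1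
  simpa using h1

/-- On an eigenvector the rescaled orbit exp(-zt) exp(tL)u has zero derivative. -/
theorem exp_smul_apply_of_eigenvector {L : E →L[ℂ] E} {u : E} {z : ℂ} (h : L u = z • u) (t : ℝ) :
    NormedSpace.exp (t • L) u = Complex.exp (z * t) • u := by
  have hd : ∀ t : ℝ, HasDerivAt
      (fun t : ℝ => Complex.exp (-z * t) • NormedSpace.exp (t • L) u) 0 t := by
    intro t
    have h1 := hasDerivAt_cexp_smul_exp_smul_apply L u z t
    have hc : L (NormedSpace.exp (t • L) u) = z • NormedSpace.exp (t • L) u := by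
      have hcomm : Commute L (NormedSpace.exp (t • L)) := by
        let _ : NormedAlgebra ℚ (E →L[ℂ] E) := NormedAlgebra.restrictScalars ℚ ℂ (E →L[ℂ] E)
        exact ((Commute.refl L).smul_right t).exp_right
      have := DFunLike.congr_fun hcomm.eq u
      rw [mul_apply_eq_comp, mul_apply_eq_comp, h, map_smul] at this
      exact this
    convert h1 using 1
    simp only [sub_apply, smul_apply,
      one_apply_eq_self, map_smul, hc]
    rw [sub_self, smul_zero, neg_zero]
  have hconst := is_const_of_deriv_eq_zero (fun s => (hd s).differentiableAt)
    (fun s => (hd s).deriv) t 0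
  simp only [Complex.ofReal_zero, mul_zero, Complex.exp_zero, zero_smul, NormedSpace.exp_zero,
    one_apply_eq_self, one_smul] at hconst
  nth_rewrite 2 [← hconst]
  rw [smul_smul, ← Complex.exp_add]
  simp

end Orbits

/-! ### Agreement of the L² transform with the Fourier integral -/

section FourierConsistency

variable {H : Type*} [NormedAddCommGroup H] [InnerProductSpace ℂ H] [CompleteSpace H]

/-- The Fourier transform on `L²` is given by the Fourier integral on `L¹ ∩ L²`. -/
theorem coeFn_fourierTransform_toLp {g : ℝ → H} (h1 : Integrable g)
    (h2 : MemLp g 2 (volume : Measure ℝ)) :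
    (Lp.fourierTransformₗᵢ ℝ H (h2.toLp g) : ℝ → H) =ᵐ[volume] FourierTransform.fourier g := by
  have hcont : Continuous (FourierTransform.fourier g) :=
    VectorFourier.fourierIntegral_continuous Real.continuous_fourierChar
      (by exact continuous_inner) h1
  refine ae_eq_of_integral_contDiff_smul_eq
    ((Lp.memLp _).locallyIntegrable (by norm_num)) hcont.locallyIntegrable fun φ hφ hc => ?_
  have hc' : HasCompactSupport (Complex.ofRealCLM ∘ φ) := hc.comp_left rfl
  have hφ' : ContDiff ℝ (⊤ : ℕ∞) (Complex.ofRealCLM ∘ φ) := by fun_prop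
  set ψ := hc'.toSchwartzMap hφ' with hψ
  have hψφ : ∀ t, ψ t = (φ t : ℂ) := fun _ => rfl
  -- Both transforms move onto the test function: the L² one as a tempered distribution, the
  -- integral one by Fubini.
  have hdist := DFunLike.congr_fun (Lp.fourier_toTemperedDistribution_eq (h2.toLp g)) ψ
  rw [TemperedDistribution.fourier_apply, Lp.toTemperedDistribution_apply,
    Lp.toTemperedDistribution_apply] at hdist
  have hflip : ∫ t, FourierTransform.fourier ψ t • g t = ∫ t, ψ t • FourierTransform.fourier g t := by
    have := VectorFourier.integral_fourierIntegral_smul_eq_flip (L := innerₗ ℝ)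
      (μ := volume) (ν := volume) (f := ψ) (g := g)
      Real.continuous_fourierChar continuous_inner ψ.integrable h1
    rw [flip_innerₗ] at this
    exact this
  have hl : ∫ t, FourierTransform.fourier ψ t • (h2.toLp g) t =
      ∫ t, FourierTransform.fourier ψ t • g t := by
    refine integral_congr_ae ?_
    filter_upwards [h2.coeFn_toLp] with t ht
    rw [ht]
  rw [hl, hflip] at hdist
  simp only [hψφ, Complex.coe_smul] at hdist
  exact hdist.symm

/-- The Fourier–Laplace transform is given by the Laplace integral whenever that converges
absolutely. -/
theorem fourierLaplace_toLp_of_integrable (ρ : ℝ) {f : ℝ → H} (hf : MemLp f 2 (weightedMeasure ρ))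
    (hi : Integrable fun t => Real.exp (-ρ * t) • f t) :
    (fourierLaplace ρ (hf.toLp f) : ℝ → H) =ᵐ[volume] fun t => (√(2 * Real.pi))⁻¹ •
      ∫ s : ℝ, Complex.exp (-(Complex.I * (t : ℂ) + (ρ : ℂ)) * (s : ℂ)) • f s := by
  have hm : MemLp (fun t => Real.exp (-ρ * t) • f t) 2 volume :=
    (memLp_weight_iff (w := fun t => Real.exp (-ρ * t)) (by fun_prop) (fun _ => Real.exp_pos _)
      (weight_exp ρ)).mp hf
  have h1 : expIso ρ (hf.toLp f) = hm.toLp _ := weightIso_toLp _ _ _ hf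
  have hpos : (0 : ℝ) < 2 * Real.pi := by positivity
  have hq : Measure.QuasiMeasurePreserving (fun t : ℝ => t / (2 * Real.pi)) volume volume :=
    (measurePreserving_div_two_pi.quasiMeasurePreserving).mono_right
      (withDensity_absolutelyContinuous _ _)
  rw [fourierLaplace_apply, h1]
  refine (dilationIso_apply _).trans ?_
  filter_upwards [hq.ae_eq_comp (coeFn_fourierTransform_toLp hi hm)] with t ht
  simp only [Function.comp_apply] at ht
  rw [ht, fourier_exp_mul ρ (fun _ => rfl)]

end FourierConsistency

/-! ### Orbits as elements of weighted L² -/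

section OrbitFunctions

variable {E : Type*} [NormedAddCommGroup E] [InnerProductSpace ℂ E]

omit [InnerProductSpace ℂ E] in
theorem memLp_indicator_Ioi_of_norm_le {v : ℝ → E} (hv : Continuous v) {ρ C : ℝ} (hρ : 0 < ρ)
    (hb : ∀ t, 0 < t → ‖v t‖ ≤ C * Real.exp (-ρ * t)) :
    MemLp ((Set.Ioi (0 : ℝ)).indicator v) 2 volume := by
  rw [memLp_indicator_iff_restrict measurableSet_Ioi,
    memLp_two_iff_integrable_sq_norm hv.aestronglyMeasurable]
  refine ((integrableOn_exp_mul_Ioi (by linarith : -(2 * ρ) < 0) 0).const_mul (C ^ 2)).mono'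
    (hv.norm.pow 2).aestronglyMeasurable ((ae_restrict_mem measurableSet_Ioi).mono fun t ht => ?_)
  rw [Real.norm_of_nonneg (by positivity)]
  have h1 : ‖v t‖ ^ 2 ≤ (C * Real.exp (-ρ * t)) ^ 2 := by
    have := hb t ht
    gcongr
  refine h1.trans (le_of_eq ?_)
  rw [mul_pow, ← Real.exp_nat_mul]
  congr 2
  push_cast
  ring

omit [InnerProductSpace ℂ E] in
theorem integrable_indicator_Ioi_of_norm_le {v : ℝ → E} (hv : Continuous v) {ρ C : ℝ}
    (hρ : 0 < ρ) (hb : ∀ t, 0 < t → ‖v t‖ ≤ C * Real.exp (-ρ * t)) :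
    Integrable ((Set.Ioi (0 : ℝ)).indicator v) := by
  rw [integrable_indicator_iff measurableSet_Ioi]
  exact ((integrableOn_exp_mul_Ioi (by linarith : -ρ < 0) 0).const_mul C).mono'
    hv.aestronglyMeasurable ((ae_restrict_mem measurableSet_Ioi).mono fun t ht => hb t ht)

theorem memLp_weightedMeasure_iff (ρ : ℝ) {f : ℝ → E} :
    MemLp f 2 (weightedMeasure ρ) ↔ MemLp (fun t => Real.exp (-ρ * t) • f t) 2 volume :=
  memLp_weight_iff (w := fun t => Real.exp (-ρ * t)) (by fun_prop) (fun _ => Real.exp_pos _)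
    (weight_exp ρ)

theorem ae_weightedMeasure (ρ : ℝ) : ae (weightedMeasure ρ) = ae (volume : Measure ℝ) :=
  ae_weight (w := fun t => Real.exp (-ρ * t)) (by fun_prop) (fun _ => Real.exp_pos _)
    (weight_exp ρ)

theorem memWeightedL2_congr {ρ : ℝ} {S : Submodule ℂ E} {f g : ℝ → E} (h : f =ᵐ[volume] g) :
    MemWeightedL2 ρ S f ↔ MemWeightedL2 ρ S g := by
  have h' : f =ᵐ[weightedMeasure ρ] g := by
    rw [Filter.EventuallyEq, ae_weightedMeasure]
    exact h
  refine and_congr (memLp_congr_ae h') (Filter.eventually_congr ?_)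
  filter_upwards [h] with t ht
  rw [ht]

/-- The forward orbit `t ↦ exp (t L) u`, extended by zero to the negative half line. -/
noncomputable def forwardOrbit (L : E →L[ℂ] E) (u : E) : ℝ → E :=
  (Set.Ioi (0 : ℝ)).indicator fun t => NormedSpace.exp (t • L) u

variable [CompleteSpace E]

theorem exp_smul_sub_smul_one (L : E →L[ℂ] E) (μ t : ℝ) :
    NormedSpace.exp (t • (L - (μ : ℂ) • (1 : E →L[ℂ] E))) =
      Real.exp (-μ * t) • NormedSpace.exp (t • L) := by
  set J : ℝ → E →L[ℂ] E := fun t => Real.exp (-μ * t) • NormedSpace.exp (t • L) with hJ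
  have hd : ∀ t, HasDerivAt J ((L - (μ : ℂ) • (1 : E →L[ℂ] E)) * J t) t := by
    intro t
    have h1 : HasDerivAt (fun t => Real.exp (-μ * t)) (Real.exp (-μ * t) * -μ) t := by
      simpa using ((hasDerivAt_id t).const_mul (-μ)).exp
    refine (h1.smul (hasDerivAt_exp_smul_const' L t)).congr_deriv ?_
    rw [hJ, sub_mul, smul_mul_assoc, one_mul, Complex.coe_smul]
    simp only [mul_smul, neg_smul, smul_neg, mul_smul_comm]
    rw [smul_comm μ]
    abel
  have := exp_smul_mul_of_hasDerivAt hd t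
  rw [hJ] at this
  simpa using this

/-- The shifted operator L - μ has no spectrum in the closed right half plane, so its spectral
projection Q is 1 and the whole semigroup decays. Invertibility on the line Re z = μ itself gives
the strict gain ρ. -/
theorem exists_norm_exp_smul_le {L : E →L[ℂ] E} {μ : ℝ}
    (h : ∀ z : ℂ, μ ≤ z.re → IsUnit (z • (1 : E →L[ℂ] E) - L)) :
    ∃ ρ C : ℝ, 0 < ρ ∧ ∀ t : ℝ, 0 ≤ t →
      ‖Real.exp (-μ * t) • NormedSpace.exp (t • L)‖ ≤ C * Real.exp (-ρ * t) := by
  have h' : ∀ z : ℂ, 0 ≤ z.re →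
      IsUnit (z • (1 : E →L[ℂ] E) - (L - (μ : ℂ) • (1 : E →L[ℂ] E))) := by
    intro z hz
    have := h (z + μ) (by simpa using hz)
    have h1 : z • (1 : E →L[ℂ] E) - (L - (μ : ℂ) • (1 : E →L[ℂ] E)) = (z + μ) • 1 - L := by
      rw [add_smul]
      abel
    rwa [h1]
  obtain ⟨Q, ρ, C, hρ, -, -, hb, -, hQ⟩ := exists_exponential_splitting fun z hz => h' z hz.ge
  refine ⟨ρ, C, hρ, fun t ht => ?_⟩
  have := hb t ht
  rwa [hQ h', mul_one, exp_smul_sub_smul_one] at this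

end OrbitFunctions

/-! ### Mild solutions as images of orbits -/

section MildSolution

variable {H E : Type*} [NormedAddCommGroup H] [InnerProductSpace ℂ H] [CompleteSpace H]
  [NormedAddCommGroup E] [InnerProductSpace ℂ E] [CompleteSpace E]

/-- If the symbol of the mild solution is the resolvent of `L` up to the bounded operator `Γ`,
then the mild solution is the image under `Γ` of an orbit of the semigroup generated by `L`. -/
theorem solutionOperator_ae_eq {M₀ M₁ : H →L[ℂ] H} {μ : ℝ} (h : IsAdmissibleRadius M₀ M₁ μ)
    {L : E →L[ℂ] E} {Γ : E →L[ℂ] H} {u : H} {w : E}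
    (hL : ∀ z : ℂ, μ ≤ z.re → IsUnit (z • (1 : E →L[ℂ] E) - L))
    (hsymb : ∀ (z : ℂ) (v : E), μ ≤ z.re → (z • (1 : E →L[ℂ] E) - L) v = w →
      pencilInv M₀ M₁ z (M₀ u) = Γ v) :
    (solutionOperator h u : ℝ → H) =ᵐ[volume] fun t => Γ (forwardOrbit L w t) := by
  obtain ⟨ρ, C, hρ, hb⟩ := exists_norm_exp_smul_le hL
  set v : ℝ → E := fun t => Real.exp (-μ * t) • NormedSpace.exp (t • L) w with hv
  have hvc : Continuous v :=
    (by fun_prop : Continuous fun t => Real.exp (-μ * t)).smul (continuous_exp_smul_apply L w)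
  have hvb : ∀ t, 0 < t → ‖v t‖ ≤ (C * ‖w‖) * Real.exp (-ρ * t) := by
    intro t ht
    have := ContinuousLinearMap.le_of_opNorm_le _ (hb t ht.le) w
    rw [mul_right_comm]
    exact this
  have hind : ∀ t, Real.exp (-μ * t) • Γ (forwardOrbit L w t) =
      Γ ((Set.Ioi (0 : ℝ)).indicator v t) := by
    intro t
    by_cases ht : t ∈ Set.Ioi (0 : ℝ)
    · rw [forwardOrbit, Set.indicator_of_mem ht, Set.indicator_of_mem ht, hv]
      exact (Γ.map_smul_of_tower _ _).symm
    · rw [forwardOrbit, Set.indicator_of_notMem ht, Set.indicator_of_notMem ht]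
      simp
  have hmem : MemLp (fun t => Γ (forwardOrbit L w t)) 2 (weightedMeasure μ) := by
    rw [memLp_weightedMeasure_iff]
    simp only [hind]
    exact Γ.comp_memLp' (memLp_indicator_Ioi_of_norm_le hvc hρ hvb)
  have hint : Integrable fun t => Real.exp (-μ * t) • Γ (forwardOrbit L w t) := by
    simp only [hind]
    exact Γ.integrable_comp (integrable_indicator_Ioi_of_norm_le hvc hρ hvb)
  -- The transform is injective, so it suffices to match symbols: the Laplace integral of the orbit
  -- solves (z - L)v = w, and `hsymb` then applies.
  have hfl : fourierLaplace μ (hmem.toLp _) = (memLp_solutionSymbol h u).toLp _ := by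
    apply Lp.ext
    refine (fourierLaplace_toLp_of_integrable μ hmem hint).trans
      (Filter.EventuallyEq.trans ?_ (memLp_solutionSymbol h u).coeFn_toLp.symm)
    refine Filter.Eventually.of_forall fun t => ?_
    set z : ℂ := Complex.I * t + μ with hz
    have hzre : z.re = μ := by simp [hz]
    have hon : IntegrableOn (fun s : ℝ => Complex.exp (-z * s) • NormedSpace.exp (s • L) w)
        (Set.Ioi 0) := by
      have h1 := (integrable_indicator_Ioi_of_norm_le hvc hρ hvb)
      rw [integrable_indicator_iff measurableSet_Ioi] at h1
      refine h1.norm.mono' ?_ (Filter.Eventually.of_forall fun s => ?_)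
      · exact (Continuous.smul (by fun_prop) (continuous_exp_smul_apply L w)).aestronglyMeasurable
      · rw [norm_smul, Complex.norm_exp, hv]
        simp only
        rw [norm_smul, Real.norm_eq_abs, Real.abs_exp]
        simp [hzre]
    have hres := sub_apply_integral_exp L w z hon
    simp only [solutionSymbol]
    rw [hsymb z _ hzre.ge hres, ← Γ.integral_comp_comm hon, ← integral_indicator measurableSet_Ioi]
    congr 2
    funext s
    by_cases hs : s ∈ Set.Ioi (0 : ℝ)
    · rw [forwardOrbit, Set.indicator_of_mem hs, Set.indicator_of_mem hs, map_smul]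
    · rw [forwardOrbit, Set.indicator_of_notMem hs, Set.indicator_of_notMem hs]
      simp
  have hsol : solutionOperator h u = hmem.toLp _ := by
    rw [solutionOperator, ← hfl, LinearIsometryEquiv.symm_apply_apply]
  rw [hsol]
  have := hmem.coeFn_toLp
  rwa [Filter.EventuallyEq, ae_weightedMeasure] at this

end MildSolution

/-! ### From a spectral gap to a dichotomy -/

section DichotomyOfSpectrum

variable {E : Type*} [NormedAddCommGroup E] [InnerProductSpace ℂ E] [CompleteSpace E]

/-- Half of the decay rate pays for the weight, the other half for square integrability. -/
theorem memLp_forwardOrbit {L : E →L[ℂ] E} {u : E} {ρ C : ℝ} (hρ : 0 < ρ)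
    (hb : ∀ t : ℝ, 0 ≤ t → ‖NormedSpace.exp (t • L) u‖ ≤ C * Real.exp (-ρ * t)) :
    MemLp (forwardOrbit L u) 2 (weightedMeasure (-(ρ / 2))) := by
  rw [memLp_weightedMeasure_iff]
  have h1 : (fun t => Real.exp (-(-(ρ / 2)) * t) • forwardOrbit L u t) =
      (Set.Ioi (0 : ℝ)).indicator
        fun t => Real.exp (-(-(ρ / 2)) * t) • NormedSpace.exp (t • L) u := by
    funext t
    by_cases ht : t ∈ Set.Ioi (0 : ℝ)
    · rw [forwardOrbit, Set.indicator_of_mem ht, Set.indicator_of_mem ht]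
    · rw [forwardOrbit, Set.indicator_of_notMem ht, Set.indicator_of_notMem ht, smul_zero]
  rw [h1]
  refine memLp_indicator_Ioi_of_norm_le (ρ := ρ / 2) (C := C)
    ((by fun_prop : Continuous fun t : ℝ => Real.exp (-(-(ρ / 2)) * t)).smul
      (continuous_exp_smul_apply L u)) (by positivity) fun t ht => ?_
  rw [norm_smul, Real.norm_eq_abs, Real.abs_exp]
  refine (mul_le_mul_of_nonneg_left (hb t ht.le) (Real.exp_pos _).le).trans (le_of_eq ?_)
  rw [mul_left_comm, ← Real.exp_add]
  congr 2
  ring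

/-- A splitting of the space as in a mild exponential dichotomy, in terms of the orbits of the
groups generated by `L` and `-L`. -/
def IsOrbitDichotomy (L : E →L[ℂ] E) (S T : Submodule ℂ E) : Prop :=
  IsClosed (S : Set E) ∧ IsClosed (T : Set E) ∧ IsCompl S T ∧ ∃ ρ : ℝ, 0 < ρ ∧
    (∀ u ∈ S, MemWeightedL2 (-ρ) S (forwardOrbit L u)) ∧
    (∀ u ∈ T, MemWeightedL2 (-ρ) T (forwardOrbit (-L) u))

theorem exists_isOrbitDichotomy {L : E →L[ℂ] E}
    (h : ∀ z : ℂ, z.re = 0 → IsUnit (z • (1 : E →L[ℂ] E) - L)) :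
    ∃ S T : Submodule ℂ E, IsOrbitDichotomy L S T ∧
      ((∀ z : ℂ, 0 ≤ z.re → IsUnit (z • (1 : E →L[ℂ] E) - L)) → S = ⊤ ∧ T = ⊥) := by
  obtain ⟨Q, ρ, C, hρ, hLQ, hQQ, hb, hb', hQ⟩ := exists_exponential_splitting h
  have hexp : ∀ {a b : E →L[ℂ] E}, Commute a b → Commute (NormedSpace.exp a) b := fun hab => by
    let _ : NormedAlgebra ℚ (E →L[ℂ] E) := NormedAlgebra.restrictScalars ℚ ℂ (E →L[ℂ] E)
    exact hab.exp_left
  have hbound : ∀ {K R : E →L[ℂ] E} {u : E}, R u = u →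
      (∀ t : ℝ, 0 ≤ t → ‖NormedSpace.exp (t • K) * R‖ ≤ C * Real.exp (-ρ * t)) →
      MemLp (forwardOrbit K u) 2 (weightedMeasure (-(ρ / 2))) := by
    intro K R u hu hK
    refine memLp_forwardOrbit (C := C * ‖u‖) hρ fun t ht => ?_
    have := ContinuousLinearMap.le_of_opNorm_le _ (hK t ht) u
    rw [mul_apply_eq_comp, hu] at this
    rwa [mul_right_comm]
  have hker : ∀ {K R : E →L[ℂ] E} {u : E}, Commute K R → R u = 0 →
      ∀ t, forwardOrbit K u t ∈ R.ker := by
    intro K R u hc hu t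
    by_cases ht : t ∈ Set.Ioi (0 : ℝ)
    · rw [forwardOrbit, Set.indicator_of_mem ht]
      have := DFunLike.congr_fun (hexp (hc.smul_left t)).eq u
      rw [mul_apply_eq_comp, mul_apply_eq_comp, hu, map_zero] at this
      exact this.symm
    · rw [forwardOrbit, Set.indicator_of_notMem ht]
      exact zero_mem _
  -- The range of Q is written as the kernel of 1 - Q, which makes closedness and invariance
  -- immediate.
  refine ⟨(1 - Q).ker, Q.ker, ⟨(1 - Q).isClosed_ker, Q.isClosed_ker, ?_, ρ / 2, by positivity,
    fun u hu => ⟨?_, ?_⟩, fun u hu => ⟨?_, ?_⟩⟩, fun hr => ?_⟩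
  · constructor
    · rw [Submodule.disjoint_def]
      intro x hx hx'
      have h1 : x - Q x = 0 := hx
      have h2 : Q x = 0 := hx'
      rwa [h2, sub_zero] at h1
    · rw [codisjoint_iff, Submodule.eq_top_iff']
      intro x
      have hQx : Q (Q x) = Q x := DFunLike.congr_fun hQQ x
      refine Submodule.mem_sup.mpr ⟨Q x, ?_, x - Q x, ?_, by abel⟩
      · change Q x - Q (Q x) = 0
        rw [hQx, sub_self]
      · change Q (x - Q x) = 0
        rw [map_sub, hQx, sub_self]
  · have h1 : u - Q u = 0 := hu
    exact hbound (sub_eq_zero.mp h1).symm hb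
  · exact Filter.Eventually.of_forall (hker ((Commute.one_right L).sub_right hLQ) hu)
  · have h2 : Q u = 0 := hu
    refine hbound (R := 1 - Q) ?_ hb'
    change u - Q u = u
    rw [h2, sub_zero]
  · exact Filter.Eventually.of_forall (hker hLQ.neg_left hu)
  · rw [hQ hr]
    constructor
    · ext x; simp
    · ext x; simp

end DichotomyOfSpectrum

/-! ### From a dichotomy to a spectral gap -/

section SpectrumOfDichotomy

variable {E : Type*} [NormedAddCommGroup E] [InnerProductSpace ℂ E] [CompleteSpace E]
  {L : E →L[ℂ] E} {S T : Submodule ℂ E} {u : E} {ρ : ℝ} {z : ℂ}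

/-- Hölder: the orbit times exp(ρt) and exp(-(z + ρ)t) on the half line are both in L². -/
theorem integrableOn_of_memWeightedL2 (h : MemWeightedL2 (-ρ) S (forwardOrbit L u))
    (hz : -ρ < z.re) :
    IntegrableOn (fun t : ℝ => Complex.exp (-z * t) • NormedSpace.exp (t • L) u) (Set.Ioi 0) := by
  have h1 := (memLp_weightedMeasure_iff _).mp h.1
  have h2 : MemLp ((Set.Ioi (0 : ℝ)).indicator fun t : ℝ => Complex.exp (-(z + ρ) * t)) 2 volume :=
    memLp_indicator_Ioi_of_norm_le (ρ := z.re + ρ) (C := 1) (by fun_prop) (by linarith)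
      fun t _ => by
        rw [Complex.norm_exp, one_mul]
        simp
  have h3 := memLp_one_iff_integrable.mp (h1.smul h2 (r := 1))
  rw [← integrable_indicator_iff measurableSet_Ioi]
  refine h3.congr (Filter.Eventually.of_forall fun t => ?_)
  by_cases ht : t ∈ Set.Ioi (0 : ℝ)
  · simp only [Pi.smul_apply', forwardOrbit, Set.indicator_of_mem ht]
    rw [← Complex.coe_smul, smul_smul, Complex.ofReal_exp, ← Complex.exp_add]
    congr 2
    push_cast
    ring
  · simp [forwardOrbit, Set.indicator_of_notMem ht]

theorem exists_resolvent_of_memWeightedL2 (h : MemWeightedL2 (-ρ) S (forwardOrbit L u))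
    (hz : -ρ < z.re) : ∃ v, (z • (1 : E →L[ℂ] E) - L) v = u :=
  ⟨_, sub_apply_integral_exp L u z (integrableOn_of_memWeightedL2 h hz)⟩

theorem eq_zero_of_memWeightedL2 (h : MemWeightedL2 (-ρ) S (forwardOrbit L u))
    (hz : -ρ < z.re) (hu : (z • (1 : E →L[ℂ] E) - L) u = 0) : u = 0 := by
  have hu' : L u = z • u := (sub_eq_zero.mp hu).symm
  have h1 := integrableOn_of_memWeightedL2 h hz
  have h2 : (fun t : ℝ => Complex.exp (-z * t) • NormedSpace.exp (t • L) u) = fun _ => u := by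
    funext t
    rw [exp_smul_apply_of_eigenvector hu', smul_smul, ← Complex.exp_add]
    simp
  -- A constant is integrable on a half line of infinite measure only if it is zero.
  rw [h2, integrableOn_const_iff] at h1
  simpa using h1

/-- L u is the right derivative of the orbit at 0. The orbit lies in S at almost every time, hence
at times arbitrarily close to 0, and the difference quotients there converge within the closed set
S. -/
theorem mem_of_memWeightedL2 (hS : IsClosed (S : Set E)) (hu : u ∈ S)
    (h : MemWeightedL2 (-ρ) S (forwardOrbit L u)) : L u ∈ S := by
  have hd := hasDerivAt_exp_smul_apply L u 0
  rw [zero_smul, NormedSpace.exp_zero, one_apply_eq_self] at hd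
  have ht := hd.tendsto_slope_zero_right
  refine hS.mem_of_frequently_of_tendsto ?_ ht
  have hdense := Measure.dense_of_ae h.2
  have hfreq : ∃ᶠ t in nhdsWithin (0 : ℝ) (Set.Ioi 0), forwardOrbit L u t ∈ S := by
    rw [(nhdsGT_basis (0 : ℝ)).frequently_iff]
    intro ε hε
    obtain ⟨t, ht1, ht2⟩ := hdense.exists_mem_open isOpen_Ioo (Set.nonempty_Ioo.mpr hε)
    exact ⟨t, ht2, ht1⟩
  refine (hfreq.and_eventually self_mem_nhdsWithin).mono fun t ht => ?_
  have h1 := ht.1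
  rw [forwardOrbit, Set.indicator_of_mem (Set.mem_Ioi.mpr ht.2)] at h1
  rw [zero_add, zero_smul, NormedSpace.exp_zero, one_apply_eq_self]
  rw [← Complex.coe_smul]
  exact S.smul_mem _ (S.sub_mem h1 hu)

/-- On the axis both z and -z lie to the right of -ρ, so Laplace transforms along L at z and along
-L at -z solve the resolvent equation for the components in S and T. For injectivity, invariance of
S and T splits the kernel equation into two eigenvector equations. -/
theorem IsOrbitDichotomy.isUnit (h : IsOrbitDichotomy L S T) (hz : z.re = 0) :
    IsUnit (z • (1 : E →L[ℂ] E) - L) := by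
  obtain ⟨hSc, hTc, hST, ρ, hρ, hS, hT⟩ := h
  have hneg : ∀ v, (-z • (1 : E →L[ℂ] E) - -L) v = -((z • (1 : E →L[ℂ] E) - L) v) := by
    intro v
    simp
    abel
  have hz1 : -ρ < z.re := by rw [hz]; linarith
  have hz2 : -ρ < (-z).re := by rw [Complex.neg_re, hz]; linarith
  rw [ContinuousLinearMap.isUnit_iff_bijective]
  constructor
  · rw [injective_iff_map_eq_zero]
    intro w hw
    obtain ⟨s, hs, t, ht, rfl⟩ := Submodule.mem_sup.mp
      (hST.sup_eq_top ▸ Submodule.mem_top : w ∈ S ⊔ T)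
    rw [map_add] at hw
    have hs' : (z • (1 : E →L[ℂ] E) - L) s ∈ S :=
      S.sub_mem (S.smul_mem z hs) (mem_of_memWeightedL2 hSc hs (hS s hs))
    have hLt : L t ∈ T := by
      have := T.neg_mem (mem_of_memWeightedL2 hTc ht (hT t ht))
      rwa [neg_apply, neg_neg] at this
    have ht' : (z • (1 : E →L[ℂ] E) - L) t ∈ T := T.sub_mem (T.smul_mem z ht) hLt
    have hs0 : (z • (1 : E →L[ℂ] E) - L) s = 0 := by
      refine (Submodule.disjoint_def.mp hST.disjoint) _ hs' ?_
      rw [eq_neg_of_add_eq_zero_left hw]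
      exact T.neg_mem ht'
    have ht0 : (z • (1 : E →L[ℂ] E) - L) t = 0 := by rwa [hs0, zero_add] at hw
    rw [eq_zero_of_memWeightedL2 (hS s hs) hz1 hs0,
      eq_zero_of_memWeightedL2 (hT t ht) hz2 (by rw [hneg, ht0, neg_zero]), add_zero]
  · intro w
    obtain ⟨s, hs, t, ht, rfl⟩ := Submodule.mem_sup.mp
      (hST.sup_eq_top ▸ Submodule.mem_top : w ∈ S ⊔ T)
    obtain ⟨x, hx⟩ := exists_resolvent_of_memWeightedL2 (hS s hs) hz1
    obtain ⟨y, hy⟩ := exists_resolvent_of_memWeightedL2 (hT t ht) hz2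
    rw [hneg] at hy
    exact ⟨x + -y, by rw [map_add, map_neg, hx, hy]⟩

theorem IsOrbitDichotomy.isUnit_of_top (h : IsOrbitDichotomy L ⊤ ⊥) (hz : 0 ≤ z.re) :
    IsUnit (z • (1 : E →L[ℂ] E) - L) := by
  obtain ⟨-, -, -, ρ, hρ, hS, -⟩ := h
  have hz1 : -ρ < z.re := by linarith
  rw [ContinuousLinearMap.isUnit_iff_bijective]
  refine ⟨?_, fun w => exists_resolvent_of_memWeightedL2 (hS w trivial) hz1⟩
  rw [injective_iff_map_eq_zero]
  exact fun w hw => eq_zero_of_memWeightedL2 (hS w trivial) hz1 hw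

end SpectrumOfDichotomy

/-! ### Exchanging the factors of a product -/

section BlockOperators

variable {H E : Type*} [NormedAddCommGroup H] [InnerProductSpace ℂ H] [CompleteSpace H]
  [NormedAddCommGroup E] [InnerProductSpace ℂ E] [CompleteSpace E]
  {a : E →L[ℂ] H} {p : H →L[ℂ] E} {W : E →L[ℂ] E} {s : ℂ}

/-- Jacobson's swap: a carries solutions for p a to solutions for a p, and f - s p y undoes this. -/
theorem isUnit_one_add_smul_comp_swap (h : IsUnit (1 + s • (a ∘L p))) :
    IsUnit (1 + s • (p ∘L a)) := by
  rw [ContinuousLinearMap.isUnit_iff_bijective] at h ⊢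
  have h1 : ∀ x, (1 + s • (a ∘L p)) x = x + s • a (p x) := fun _ => rfl
  have h2 : ∀ e, (1 + s • (p ∘L a)) e = e + s • p (a e) := fun _ => rfl
  constructor
  · rw [injective_iff_map_eq_zero]
    intro e he
    rw [h2] at he
    have h3 : a e = 0 := (injective_iff_map_eq_zero _).mp h.1 _ (by
      rw [h1, ← map_smul, ← map_add, he, map_zero])
    rwa [h3, map_zero, smul_zero, add_zero] at he
  · intro f
    obtain ⟨y, hy⟩ := h.2 (a f)
    rw [h1] at hy
    refine ⟨f - s • p y, ?_⟩
    have h3 : a (f - s • p y) = y := by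
      rw [map_sub, map_smul, ← hy, add_sub_cancel_right]
    rw [h2, h3, sub_add_cancel]

/-- Since W = (p a)⁻¹, the operator W + s is W(1 + s p a), so this is the same exchange. -/
theorem isUnit_add_smul_one_of_isUnit (h1 : ∀ e, p (a (W e)) = e) (h2 : ∀ e, W (p (a e)) = e)
    (h : IsUnit (1 + s • (a ∘L p))) : IsUnit (W + s • (1 : E →L[ℂ] E)) := by
  rw [ContinuousLinearMap.isUnit_iff_bijective] at h ⊢
  have h3 : ∀ x, (1 + s • (a ∘L p)) x = x + s • a (p x) := fun _ => rfl
  have h4 : ∀ e, (W + s • (1 : E →L[ℂ] E)) e = W e + s • e := fun _ => rfl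
  constructor
  · rw [injective_iff_map_eq_zero]
    intro e he
    rw [h4] at he
    have h5 : a (W e) = 0 := (injective_iff_map_eq_zero _).mp h.1 _ (by
      rw [h3, h1, ← map_smul, ← map_add, he, map_zero])
    rw [← h1 e, h5, map_zero]
  · intro f
    obtain ⟨y, hy⟩ := h.2 (a f)
    rw [h3] at hy
    refine ⟨p y, ?_⟩
    have h5 : a (f - s • p y) = y := by
      rw [map_sub, map_smul, ← hy, add_sub_cancel_right]
    have h6 := h2 (f - s • p y)
    rw [h5] at h6
    rw [h4, h6, sub_add_cancel]

omit [CompleteSpace H] [CompleteSpace E] in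
/-- The inverse of `1 + s a p` in terms of the inverse of `W + s`, where `W = (p a)⁻¹`. -/
theorem inverse_one_add_smul_comp (h1 : ∀ e, p (a (W e)) = e) (h2 : ∀ e, W (p (a e)) = e)
    (h : IsUnit (W + s • (1 : E →L[ℂ] E))) :
    IsUnit (1 + s • (a ∘L p)) ∧ Ring.inverse (1 + s • (a ∘L p)) =
      1 - s • (a ∘L W ∘L Ring.inverse (W + s • (1 : E →L[ℂ] E)) ∘L p) := by
  set R := Ring.inverse (W + s • (1 : E →L[ℂ] E)) with hR
  have hR1 : ∀ e, W (R e) + s • R e = e := DFunLike.congr_fun (Ring.mul_inverse_cancel _ h)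
  have hR2 : ∀ e, R (W e + s • e) = e := DFunLike.congr_fun (Ring.inverse_mul_cancel _ h)
  set N := 1 + s • (a ∘L p) with hN
  set Y := 1 - s • (a ∘L W ∘L R ∘L p) with hY
  have hNa : ∀ x, N x = x + s • a (p x) := fun _ => rfl
  have hYa : ∀ x, Y x = x - s • a (W (R (p x))) := fun _ => rfl
  have hNY : N * Y = 1 := by
    ext x
    rw [mul_apply_eq_comp, hNa, hYa, map_sub, map_smul, h1]
    have h3 : p x - s • R (p x) = W (R (p x)) := by
      rw [sub_eq_iff_eq_add]
      exact (hR1 _).symm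
    rw [h3, sub_add_cancel, one_apply_eq_self]
  have hYN : Y * N = 1 := by
    ext x
    rw [mul_apply_eq_comp, hYa, hNa, map_add, map_smul]
    have h3 : p x + s • p (a (p x)) = W (p (a (p x))) + s • p (a (p x)) := by rw [h2]
    rw [h3, hR2, h2, add_sub_cancel_right, one_apply_eq_self]
  let u : (H →L[ℂ] H)ˣ := ⟨N, Y, hNY, hYN⟩
  exact ⟨u.isUnit, Ring.inverse_unit u⟩

end BlockOperators

/-! ### Reduction of the pencil to a bounded generator -/

section Reduction

variable {H : Type*} [NormedAddCommGroup H] [InnerProductSpace ℂ H] [CompleteSpace H]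
  {M₀ M₁ : H →L[ℂ] H}

theorem apply_orthogonalProjectionOnto_ker (M : H →L[ℂ] H) (x : H) :
    M ((M.ker)ᗮ.orthogonalProjectionOnto x : H) = M x := by
  have h := Submodule.sub_starProjection_mem_orthogonal (K := (M.ker)ᗮ) x
  rw [Submodule.orthogonal_orthogonal] at h
  have h2 : M (x - ((M.ker)ᗮ.orthogonalProjectionOnto x : H)) = 0 := h
  rw [map_sub, sub_eq_zero] at h2
  exact h2.symm

/-- The restriction of M to the complement of its kernel is injective with the same closed range,
hence bounded below. -/
theorem exists_norm_le_of_isClosed_range {M : H →L[ℂ] H} (hM : IsClosed (Set.range M)) :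
    ∃ c : ℝ, 0 ≤ c ∧ ∀ e : (M.ker)ᗮ, ‖e‖ ≤ c * ‖M (e : H)‖ := by
  set f : (M.ker)ᗮ →L[ℂ] H := M ∘L (M.ker)ᗮ.subtypeL with hf
  have hinj : Function.Injective f := by
    rw [injective_iff_map_eq_zero]
    intro e he
    have h1 : (e : H) ∈ M.ker := he
    have h2 := Submodule.inner_right_of_mem_orthogonal h1 e.2
    exact Subtype.ext (inner_self_eq_zero.mp h2)
  have hrange : Set.range f = Set.range M := by
    apply Set.Subset.antisymm
    · rintro _ ⟨e, rfl⟩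
      exact ⟨e, rfl⟩
    · rintro _ ⟨x, rfl⟩
      exact ⟨_, apply_orthogonalProjectionOnto_ker M x⟩
  obtain ⟨c, hc⟩ := f.antilipschitz_of_injective_of_isClosed_range hinj (hrange ▸ hM)
  refine ⟨c, c.2, fun e => ?_⟩
  have := hc.le_mul_dist e 0
  simpa [hf, dist_eq_norm] using this

theorem pencilInv_mul_pencil {x : ℂ} (hx : x ∉ pencilSpectrum M₀ M₁) (z : ℂ) :
    pencilInv M₀ M₁ x * pencil M₀ M₁ z = 1 + (z - x) •
      ((pencilInv M₀ M₁ x ∘L M₀ ∘L (M₀.ker)ᗮ.subtypeL) ∘L (M₀.ker)ᗮ.orthogonalProjectionOnto) := by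
  have h1 : pencil M₀ M₁ z = pencil M₀ M₁ x + (z - x) • M₀ := by
    rw [pencil, pencil, sub_smul]
    abel
  rw [h1, mul_add, pencilInv, Ring.inverse_mul_cancel _ (isUnit_pencil hx), mul_smul_comm]
  congr 2
  ext y
  change _ = Ring.inverse (pencil M₀ M₁ x) (M₀ ((M₀.ker)ᗮ.orthogonalProjectionOnto y : H))
  rw [apply_orthogonalProjectionOnto_ker]
  rfl

theorem isUnit_pencil_iff {x : ℂ} (hx : x ∉ pencilSpectrum M₀ M₁) (z : ℂ) :
    IsUnit (pencil M₀ M₁ z) ↔ IsUnit (1 + (z - x) •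
      ((pencilInv M₀ M₁ x ∘L M₀ ∘L (M₀.ker)ᗮ.subtypeL) ∘L
        (M₀.ker)ᗮ.orthogonalProjectionOnto)) := by
  rw [← pencilInv_mul_pencil hx z]
  obtain ⟨u, hu⟩ := isUnit_pencil hx
  rw [pencilInv, ← hu, Ring.inverse_unit]
  exact (Units.isUnit_units_mul u⁻¹ _).symm

omit [CompleteSpace H] in
theorem notMem_pencilSpectrum_iff {z : ℂ} :
    z ∉ pencilSpectrum M₀ M₁ ↔ IsUnit (pencil M₀ M₁ z) :=
  spectrum.zero_notMem_iff (R := ℂ) (a := pencil M₀ M₁ z)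

/-- For a regular pencil the compression of `(x M₀ + M₁)⁻¹ M₀` to the orthogonal complement of the
kernel of `M₀` is invertible. -/
theorem IsRegularPencil.exists_isUnit_compression (hclosed : IsClosed (Set.range M₀))
    (hreg : IsRegularPencil M₀ M₁) :
    ∃ x : ℂ, x ∉ pencilSpectrum M₀ M₁ ∧ IsUnit ((M₀.ker)ᗮ.orthogonalProjectionOnto ∘L
      (pencilInv M₀ M₁ x ∘L M₀ ∘L (M₀.ker)ᗮ.subtypeL)) := by
  obtain ⟨ν, hν, C, hC⟩ := hreg
  set x : ℂ := ((ν + 1 : ℝ) : ℂ) with hx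
  have hxν : ν < x.re := by simp [hx]
  have hxs := hν x hxν
  refine ⟨x, hxs, ?_⟩
  set p := (M₀.ker)ᗮ.orthogonalProjectionOnto with hp
  set B := pencilInv M₀ M₁ x with hB
  set a : (M₀.ker)ᗮ →L[ℂ] H := B ∘L M₀ ∘L (M₀.ker)ᗮ.subtypeL with ha
  obtain ⟨c, hc0, hc⟩ := exists_norm_le_of_isClosed_range hclosed
  set b := ‖pencil M₀ M₁ x‖ with hb
  have hBM : ∀ y, pencil M₀ M₁ x (B y) = y :=
    DFunLike.congr_fun (Ring.mul_inverse_cancel _ (isUnit_pencil hxs))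
  have hac : ∀ e, ‖e‖ ≤ c * b * ‖a e‖ := by
    intro e
    refine (hc e).trans ?_
    rw [mul_assoc]
    refine mul_le_mul_of_nonneg_left ?_ hc0
    have h1 : pencil M₀ M₁ x (a e) = M₀ (e : H) := hBM _
    rw [← h1]
    exact (pencil M₀ M₁ x).le_opNorm _
  have hC0 : 0 ≤ C := (norm_nonneg _).trans (hC x hxν)
  set D := C * b with hD
  -- The estimate below reads s‖Xe‖ ≤ c b (1 + D)‖e‖; the factor 2 yields ‖X‖ ≤ 1/2 and the summand
  -- 1 keeps s positive.
  set s : ℝ := 2 * (c * b * (1 + D)) + 1 with hs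
  have hcb : 0 ≤ c * b := mul_nonneg hc0 (norm_nonneg _)
  have hD0 : 0 ≤ D := mul_nonneg hC0 (norm_nonneg _)
  have hs0 : 0 < s := by positivity
  set z : ℂ := x + s with hz
  have hzν : ν < z.re := by
    rw [hz, Complex.add_re, Complex.ofReal_re s]
    linarith
  have hzs := hν z hzν
  have hzx : z - x = (s : ℂ) := by rw [hz, add_sub_cancel_left]
  have hN := (isUnit_pencil_iff hxs z).mp (isUnit_pencil hzs)
  rw [hzx] at hN
  have hBz := pencilInv_mul_pencil hxs z
  rw [hzx] at hBz
  have hK := isUnit_one_add_smul_comp_swap hN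
  set X := Ring.inverse (1 + (s : ℂ) • (p ∘L a)) with hX
  have hXle : ‖X‖ ≤ 1 / 2 := by
    refine X.opNorm_le_bound (by norm_num) fun e => ?_
    have hXe : X e + (s : ℂ) • p (a (X e)) = e :=
      DFunLike.congr_fun (Ring.mul_inverse_cancel _ hK) e
    -- A preimage of e under 1 + s a p. Its norm is controlled by the half plane bound independently
    -- of s, and p y = X e.
    set y : H := pencilInv M₀ M₁ z (pencil M₀ M₁ x e) with hy
    have hyN : y + (s : ℂ) • a (p y) = e := by
      have h1 := DFunLike.congr_fun hBz y
      have h2 : pencil M₀ M₁ z y = pencil M₀ M₁ x e :=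
        DFunLike.congr_fun (Ring.mul_inverse_cancel _ (isUnit_pencil hzs)) (pencil M₀ M₁ x e)
      rw [mul_apply_eq_comp, h2] at h1
      refine h1.symm.trans ?_
      exact DFunLike.congr_fun (Ring.inverse_mul_cancel _ (isUnit_pencil hxs)) (e : H)
    have hyle : ‖y‖ ≤ D * ‖e‖ := by
      rw [hD, mul_assoc]
      refine ((pencilInv M₀ M₁ z).le_of_opNorm_le (hC z hzν) _).trans ?_
      gcongr
      exact (pencil M₀ M₁ x).le_opNorm _
    have hpy : p y = X e := by
      have h1 : p y + (s : ℂ) • p (a (p y)) = e := by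
        have h2 := congrArg p hyN
        rw [map_add, map_smul] at h2
        rw [h2]
        exact Submodule.orthogonalProjectionOnto_mem_subspace_eq_self e
      have h3 := (ContinuousLinearMap.isUnit_iff_bijective.mp hK).1
      exact h3 (h1.trans hXe.symm)
    have h1 : s * ‖a (X e)‖ ≤ (1 + D) * ‖e‖ := by
      have h2 : (s : ℂ) • a (X e) = e - y := by
        rw [← hpy, ← hyN, add_sub_cancel_left]
      have h3 : ‖(s : ℂ) • a (X e)‖ = s * ‖a (X e)‖ := by
        rw [norm_smul, Complex.norm_real, Real.norm_of_nonneg hs0.le]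
      rw [← h3, h2]
      refine (norm_sub_le _ _).trans ?_
      rw [add_mul, one_mul]
      exact add_le_add le_rfl hyle
    have h4 : s * ‖X e‖ ≤ s * (1 / 2 * ‖e‖) := by
      calc s * ‖X e‖ ≤ s * (c * b * ‖a (X e)‖) := by gcongr; exact hac _
        _ = c * b * (s * ‖a (X e)‖) := by ring
        _ ≤ c * b * ((1 + D) * ‖e‖) := by gcongr
        _ ≤ s * (1 / 2 * ‖e‖) := by
          rw [hs]
          nlinarith [norm_nonneg e]
    exact le_of_mul_le_mul_left h4 hs0
  -- Here 1 - X is invertible by a Neumann series.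
  have h1 : (s : ℂ) • (p ∘L a) = (1 - X) * (1 + (s : ℂ) • (p ∘L a)) := by
    rw [sub_mul, one_mul, hX, Ring.inverse_mul_cancel _ hK, add_sub_cancel_left]
  have h2 : IsUnit ((s : ℂ) • (p ∘L a)) := by
    rw [h1]
    exact (isUnit_one_sub_of_norm_lt_one (by linarith)).mul hK
  have hs0' : (s : ℂ) ≠ 0 := by exact_mod_cast hs0.ne'
  have h3 := isUnit_smul_of_ne_zero (A := (M₀.ker)ᗮ →L[ℂ] (M₀.ker)ᗮ) (inv_ne_zero hs0') h2
  rwa [smul_smul, inv_mul_cancel₀ hs0', one_smul] at h3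

/-- A regular pencil is equivalent to the resolvent of a bounded operator on the orthogonal
complement of the kernel of `M₀`. -/
theorem IsRegularPencil.exists_generator (hclosed : IsClosed (Set.range M₀))
    (hreg : IsRegularPencil M₀ M₁) :
    ∃ (L : (M₀.ker)ᗮ →L[ℂ] (M₀.ker)ᗮ) (Γ : (M₀.ker)ᗮ →L[ℂ] H) (B : H →L[ℂ] H) (x : ℂ),
      (∀ e, (M₀.ker)ᗮ.orthogonalProjectionOnto (Γ e) = e) ∧
      (∀ z : ℂ, z ∉ pencilSpectrum M₀ M₁ ↔ IsUnit (z • (1 : (M₀.ker)ᗮ →L[ℂ] (M₀.ker)ᗮ) - L)) ∧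
      (∀ z : ℂ, IsUnit (z • (1 : (M₀.ker)ᗮ →L[ℂ] (M₀.ker)ᗮ) - L) →
        pencilInv M₀ M₁ z = (1 - (z - x) • (Γ ∘L
          Ring.inverse (z • (1 : (M₀.ker)ᗮ →L[ℂ] (M₀.ker)ᗮ) - L) ∘L
            (M₀.ker)ᗮ.orthogonalProjectionOnto)) * B) ∧
      ∀ (z : ℂ) (u : H) (v : (M₀.ker)ᗮ),
        IsUnit (z • (1 : (M₀.ker)ᗮ →L[ℂ] (M₀.ker)ᗮ) - L) →
        (z • (1 : (M₀.ker)ᗮ →L[ℂ] (M₀.ker)ᗮ) - L) v = (M₀.ker)ᗮ.orthogonalProjectionOnto u →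
        pencilInv M₀ M₁ z (M₀ u) = Γ v := by
  obtain ⟨x, hx, hunit⟩ := hreg.exists_isUnit_compression hclosed
  set p := (M₀.ker)ᗮ.orthogonalProjectionOnto with hp
  set B := pencilInv M₀ M₁ x with hB
  set a : (M₀.ker)ᗮ →L[ℂ] H := B ∘L M₀ ∘L (M₀.ker)ᗮ.subtypeL with ha
  set W := Ring.inverse (p ∘L a) with hW
  have h1 : ∀ e, p (a (W e)) = e := DFunLike.congr_fun (Ring.mul_inverse_cancel _ hunit)
  have h2 : ∀ e, W (p (a e)) = e := DFunLike.congr_fun (Ring.inverse_mul_cancel _ hunit)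
  have hzL : ∀ z : ℂ, z • (1 : (M₀.ker)ᗮ →L[ℂ] (M₀.ker)ᗮ) - (x • 1 - W) =
      W + (z - x) • (1 : (M₀.ker)ᗮ →L[ℂ] (M₀.ker)ᗮ) := by
    intro z
    refine ContinuousLinearMap.ext fun e => ?_
    change z • e - (x • e - W e) = W e + (z - x) • e
    rw [sub_smul]
    abel
  have hinv : ∀ z : ℂ, IsUnit (W + (z - x) • (1 : (M₀.ker)ᗮ →L[ℂ] (M₀.ker)ᗮ)) →
      IsUnit (pencil M₀ M₁ z) ∧ pencilInv M₀ M₁ z = (1 - (z - x) • (a ∘L W ∘L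
        Ring.inverse (W + (z - x) • (1 : (M₀.ker)ᗮ →L[ℂ] (M₀.ker)ᗮ)) ∘L p)) * B := by
    intro z hz
    obtain ⟨hN, hNinv⟩ := inverse_one_add_smul_comp h1 h2 hz
    have hu := (isUnit_pencil_iff hx z).mpr hN
    refine ⟨hu, ?_⟩
    rw [pencilInv, ← mul_one (Ring.inverse (pencil M₀ M₁ z)),
      Ring.inverse_mul_eq_iff_eq_mul _ _ _ hu]
    have h3 : pencil M₀ M₁ z = pencil M₀ M₁ x * (1 + (z - x) • (a ∘L p)) := by
      rw [← pencilInv_mul_pencil hx z, ← mul_assoc, pencilInv,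
        Ring.mul_inverse_cancel _ (isUnit_pencil hx), one_mul]
    rw [h3, ← mul_assoc, mul_assoc (pencil M₀ M₁ x), ← hNinv,
      Ring.mul_inverse_cancel _ hN, mul_one, hB, pencilInv,
      Ring.mul_inverse_cancel _ (isUnit_pencil hx)]
  -- With this L one has z - L = W + (z - x).
  refine ⟨x • 1 - W, a ∘L W, B, x, h1, fun z => ?_, fun z hz => ?_, fun z u v hz hv => ?_⟩
  · rw [hzL, notMem_pencilSpectrum_iff]
    exact ⟨fun h => isUnit_add_smul_one_of_isUnit h1 h2 ((isUnit_pencil_iff hx z).mp h),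
      fun h => (hinv z h).1⟩
  · rw [hzL] at hz ⊢
    exact (hinv z hz).2
  · rw [hzL] at hz hv
    have hu := (hinv z hz).1
    have hinj := (ContinuousLinearMap.isUnit_iff_bijective.mp hu).1
    apply hinj
    have h3 : pencil M₀ M₁ z (pencilInv M₀ M₁ z (M₀ u)) = M₀ u :=
      DFunLike.congr_fun (Ring.mul_inverse_cancel _ hu) (M₀ u)
    rw [h3]
    have hxinj := (ContinuousLinearMap.isUnit_iff_bijective.mp
      (isUnit_pencil hx).ringInverse).1
    apply hxinj
    -- After cancelling M(z)⁻¹ and applying M(x)⁻¹, the claim is a(Wv + (z - x)v) = a(p u).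
    have h4 := DFunLike.congr_fun (pencilInv_mul_pencil hx z) (a (W v))
    rw [mul_apply_eq_comp] at h4
    refine Eq.trans ?_ h4.symm
    change B (M₀ u) = a (W v) + (z - x) • a (p (a (W v)))
    rw [h1, ← map_smul, ← map_add]
    have h5 : W v + (z - x) • v = p u := hv
    rw [h5]
    change _ = B (M₀ (p u : H))
    rw [apply_orthogonalProjectionOnto_ker]

end Reduction

/-! ### Admissible radii and transfer to the generator -/

section MainTheorem

theorem isUnit_smul_one_sub_of_norm_le {A : Type*} [NormedRing A] [NormedAlgebra ℂ A]
    [CompleteSpace A] {L : A} {z : ℂ} (hz : 2 * ‖L‖ + 1 ≤ ‖z‖) : IsUnit (z • (1 : A) - L) := by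
  have hz0 : z ≠ 0 := by
    rintro rfl
    rw [norm_zero] at hz
    linarith [norm_nonneg L]
  have h1 : z • (1 : A) - L = z • (1 - z⁻¹ • L) := by
    rw [smul_sub, smul_smul, mul_inv_cancel₀ hz0, one_smul]
  rw [h1]
  refine isUnit_smul_of_ne_zero hz0 (isUnit_one_sub_of_norm_lt_one ?_)
  rw [norm_smul, norm_inv, inv_mul_lt_one₀ (norm_pos_iff.mpr hz0)]
  linarith [norm_nonneg L]

theorem norm_mul_norm_inverse_le {E : Type*} [NormedAddCommGroup E] [InnerProductSpace ℂ E]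
    [CompleteSpace E] {L : E →L[ℂ] E} {z : ℂ} (hz : 2 * ‖L‖ + 1 ≤ ‖z‖) :
    ‖z‖ * ‖Ring.inverse (z • (1 : E →L[ℂ] E) - L)‖ ≤ 2 := by
  have hz0 : 0 < ‖z‖ := by linarith [norm_nonneg L]
  rw [← le_div_iff₀' hz0]
  refine ContinuousLinearMap.opNorm_le_bound _ (by positivity) fun e => ?_
  set f := Ring.inverse (z • (1 : E →L[ℂ] E) - L) e with hf
  have h1 : z • f - L f = e :=
    DFunLike.congr_fun (Ring.mul_inverse_cancel _ (isUnit_smul_one_sub_of_norm_le hz)) e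
  have h2 : ‖z‖ * ‖f‖ ≤ ‖e‖ + ‖L‖ * ‖f‖ := by
    rw [← norm_smul, sub_eq_iff_eq_add.mp h1]
    exact (norm_add_le _ _).trans (add_le_add le_rfl (L.le_opNorm f))
  rw [div_mul_eq_mul_div, le_div_iff₀ hz0]
  nlinarith [norm_nonneg f]

variable {H : Type*} [NormedAddCommGroup H] [InnerProductSpace ℂ H] [CompleteSpace H]
  {M₀ M₁ : H →L[ℂ] H}

theorem IsRegularPencil.exists_isAdmissibleRadius (hclosed : IsClosed (Set.range M₀))
    (hreg : IsRegularPencil M₀ M₁) : ∃ μ : ℝ, IsAdmissibleRadius M₀ M₁ μ := by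
  obtain ⟨L, Γ, B, x, -, hspec, hinv, -⟩ := hreg.exists_generator hclosed
  -- Outside this ball the resolvent is at most 2/‖z‖ and ‖z - x‖ ≤ 2‖z‖, so the product in the
  -- formula for the inverse is bounded by 4.
  set μ : ℝ := 2 * ‖L‖ + ‖x‖ + 1 with hμ
  have hμ0 : 0 < μ := by positivity
  have hball : ∀ z : ℂ, z ∉ Metric.ball (0 : ℂ) μ → 2 * ‖L‖ + 1 ≤ ‖z‖ ∧ ‖x‖ ≤ ‖z‖ := by
    intro z hz
    rw [mem_ball_zero_iff, not_lt] at hz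
    constructor <;> linarith [norm_nonneg L, norm_nonneg x]
  have hunit : ∀ z : ℂ, z ∉ Metric.ball (0 : ℂ) μ →
      IsUnit (z • (1 : (M₀.ker)ᗮ →L[ℂ] (M₀.ker)ᗮ) - L) := fun z hz =>
    isUnit_smul_one_sub_of_norm_le (A := (M₀.ker)ᗮ →L[ℂ] (M₀.ker)ᗮ) (hball z hz).1
  refine ⟨μ, hμ0, fun z hz => (hspec z).mpr (hunit z hz),
    (‖(1 : H →L[ℂ] H)‖ + ‖Γ‖ * 4 * ‖(M₀.ker)ᗮ.orthogonalProjectionOnto‖) * ‖B‖, fun z hz => ?_⟩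
  rw [hinv z (hunit z hz)]
  refine (norm_mul_le _ _).trans (mul_le_mul_of_nonneg_right ?_ (norm_nonneg _))
  refine (norm_sub_le _ _).trans (add_le_add le_rfl ?_)
  rw [norm_smul]
  set R := Ring.inverse (z • (1 : (M₀.ker)ᗮ →L[ℂ] (M₀.ker)ᗮ) - L) with hR
  set p := (M₀.ker)ᗮ.orthogonalProjectionOnto
  have h1 : ‖z - x‖ * ‖R‖ ≤ 4 := by
    have h2 := norm_mul_norm_inverse_le (hball z hz).1
    have h3 : ‖z - x‖ ≤ 2 * ‖z‖ := (norm_sub_le _ _).trans (by linarith [(hball z hz).2])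
    calc ‖z - x‖ * ‖R‖ ≤ 2 * ‖z‖ * ‖R‖ := by gcongr
      _ ≤ 4 := by linarith
  have h4 : ‖Γ ∘L R ∘L p‖ ≤ ‖Γ‖ * (‖R‖ * ‖p‖) :=
    (ContinuousLinearMap.opNorm_comp_le _ _).trans
      (mul_le_mul_of_nonneg_left (ContinuousLinearMap.opNorm_comp_le _ _) (norm_nonneg _))
  calc ‖z - x‖ * ‖Γ ∘L R ∘L p‖ ≤ ‖z - x‖ * (‖Γ‖ * (‖R‖ * ‖p‖)) := by gcongr
    _ = ‖Γ‖ * (‖z - x‖ * ‖R‖) * ‖p‖ := by ring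
    _ ≤ ‖Γ‖ * 4 * ‖p‖ := by gcongr

omit [CompleteSpace H] in
theorem pencilInv_neg {z : ℂ} (hz : -z ∉ pencilSpectrum M₀ M₁) :
    pencilInv M₀ (-M₁) z = -pencilInv M₀ M₁ (-z) := by
  obtain ⟨u, hu⟩ := isUnit_pencil hz
  rw [pencilInv, pencilInv, pencil_neg, ← hu, ← Units.val_neg, Ring.inverse_unit,
    Ring.inverse_unit, inv_neg, Units.val_neg]

theorem projectedSolution_ae_eq {μ : ℝ} (h : IsAdmissibleRadius M₀ M₁ μ)
    {L : (M₀.ker)ᗮ →L[ℂ] (M₀.ker)ᗮ} {Γ : (M₀.ker)ᗮ →L[ℂ] H}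
    (hΓ : ∀ e, (M₀.ker)ᗮ.orthogonalProjectionOnto (Γ e) = e)
    (hL : ∀ z : ℂ, μ ≤ z.re → IsUnit (z • (1 : (M₀.ker)ᗮ →L[ℂ] (M₀.ker)ᗮ) - L))
    (hsymb : ∀ (z : ℂ) (u : H) (v : (M₀.ker)ᗮ), μ ≤ z.re →
      (z • (1 : (M₀.ker)ᗮ →L[ℂ] (M₀.ker)ᗮ) - L) v = (M₀.ker)ᗮ.orthogonalProjectionOnto u →
      pencilInv M₀ M₁ z (M₀ u) = Γ v) (u : (M₀.ker)ᗮ) :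
    projectedSolution h (u : H) =ᵐ[volume] forwardOrbit L u := by
  have h1 := solutionOperator_ae_eq h (Γ := Γ) (u := (u : H)) (w := u) hL fun z v hz hv =>
    hsymb z u v hz (hv.trans (Submodule.orthogonalProjectionOnto_mem_subspace_eq_self u).symm)
  filter_upwards [h1] with t ht
  rw [projectedSolution, ht, hΓ]

/-- The generator depends only on the pencil and not on μ. As N(z) = -M(-z), the reversed pencil has
generator -L with the same Γ, the two signs cancelling. -/
theorem exists_isMildExpDichotomy_iff (hclosed : IsClosed (Set.range M₀))
    (hreg : IsRegularPencil M₀ M₁) :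
    ∃ L : (M₀.ker)ᗮ →L[ℂ] (M₀.ker)ᗮ,
      (∀ z : ℂ, z ∉ pencilSpectrum M₀ M₁ ↔ IsUnit (z • (1 : (M₀.ker)ᗮ →L[ℂ] (M₀.ker)ᗮ) - L)) ∧
      ∀ (μ : ℝ) (h : IsAdmissibleRadius M₀ M₁ μ) (S T : Submodule ℂ (M₀.ker)ᗮ),
        IsMildExpDichotomy h S T ↔ IsOrbitDichotomy L S T := by
  obtain ⟨L, Γ, B, x, hΓ, hspec, -, hsymb⟩ := hreg.exists_generator hclosed
  refine ⟨L, hspec, fun μ h S T => ?_⟩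
  have hball : ∀ z : ℂ, μ ≤ z.re → z ∉ pencilSpectrum M₀ M₁ ∧ -z ∉ pencilSpectrum M₀ M₁ := by
    intro z hz
    have h1 : μ ≤ ‖z‖ := hz.trans (Complex.re_le_norm z)
    exact ⟨h.notMem_spectrum z (by simpa using h1), h.notMem_spectrum (-z) (by simpa using h1)⟩
  have hu := fun z hz => (hspec z).mp (hball z hz).1
  have hu' := fun z hz => (hspec (-z)).mp (hball z hz).2
  have hneg : ∀ z : ℂ, z • (1 : (M₀.ker)ᗮ →L[ℂ] (M₀.ker)ᗮ) - -L = -(-z • 1 - L) := by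
    intro z
    refine ContinuousLinearMap.ext fun e => ?_
    change z • e - -(L e) = -(-z • e - L e)
    rw [neg_smul]
    abel
  have h1 := projectedSolution_ae_eq h hΓ hu fun z u v hz => hsymb z u v (hu z hz)
  have h2 := projectedSolution_ae_eq h.reverse (L := -L) hΓ
    (fun z hz => by rw [hneg]; exact (hu' z hz).neg) fun z u v hz hv => by
      rw [hneg] at hv
      have h3 := hsymb (-z) u (-v) (hu' z hz) (by rw [map_neg]; exact hv)
      rw [pencilInv_neg (hball z hz).2, neg_apply, h3, map_neg, neg_neg]
  rw [IsMildExpDichotomy, IsOrbitDichotomy]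
  simp only [memWeightedL2_congr (h1 _), memWeightedL2_congr (h2 _)]

end MainTheorem

theorem mainTheorem6 {H : Type*} [NormedAddCommGroup H] [InnerProductSpace ℂ H] [CompleteSpace H]
    (M₀ M₁ : H →L[ℂ] H) (hclosed : IsClosed (Set.range M₀)) (hreg : IsRegularPencil M₀ M₁) :
    (∃ μ : ℝ, IsAdmissibleRadius M₀ M₁ μ) ∧
    ∀ (μ : ℝ) (h : IsAdmissibleRadius M₀ M₁ μ),
      (AdmitsMildExpDichotomy h ↔
        pencilSpectrum M₀ M₁ ∩ {z : ℂ | z.re = 0} = ∅) ∧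
      (IsMildlyExpStable h ↔
        pencilSpectrum M₀ M₁ ⊆ {z : ℂ | z.re < 0}) := by
  refine ⟨hreg.exists_isAdmissibleRadius hclosed, fun μ h => ?_⟩
  obtain ⟨L, hspec, hiff⟩ := exists_isMildExpDichotomy_iff hclosed hreg
  constructor
  · rw [Set.eq_empty_iff_forall_notMem, AdmitsMildExpDichotomy]
    simp only [hiff]
    constructor
    · rintro ⟨S, T, hST⟩ z ⟨hz, hz0⟩
      exact (hspec z).mpr (hST.isUnit hz0) hz
    · intro hz
      obtain ⟨S, T, hST, -⟩ := exists_isOrbitDichotomy fun z hz0 =>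
        (hspec z).mp fun hzs => hz z ⟨hzs, hz0⟩
      exact ⟨S, T, hST⟩
  · rw [IsMildlyExpStable, hiff]
    constructor
    · intro hST z hz
      by_contra hz0
      exact (hspec z).mpr (hST.isUnit_of_top (not_lt.mp hz0)) hz
    · intro hz
      have hunit : ∀ z : ℂ, 0 ≤ z.re →
          IsUnit (z • (1 : (M₀.ker)ᗮ →L[ℂ] (M₀.ker)ᗮ) - L) := fun z hz0 =>
        (hspec z).mp fun hzs => absurd (hz hzs) (not_lt.mpr hz0)
      obtain ⟨S, T, hST, hST'⟩ := exists_isOrbitDichotomy fun z hz0 => hunit z hz0.ge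
      obtain ⟨rfl, rfl⟩ := hST' hunit
      exact hST
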